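/- A coloring of size $k$ of a finite simple graph $G$ is a map $\psi$ from $V(G)$ to a set of $k$ colors. A vertex $v$ of a subgraph $H$ is a center of $H$ if no other vertex of $H$ has the color of $v$. The coloring is linear if every path in $G$ (not necessarily induced) has a center, and centered if every connected subgraph of $G$ has a center. A graph is an interval graph if its vertices can be mapped injectively to intervals of the real line such that two distinct vertices are adjacent if and only if their intervals overlap. Theorem. There is a polynomial-time algorithm that takes as input an interval graph $G$ and a linear coloring of $G$ of size $k$, and outputs a centered coloring of $G$ of size at most $k^2$. The algorithm is given $G$ by its adjacency matrix (not by an interval representation), and its running time is bounded by a polynomial in the number $n$ of vertices of $G$ alone, on a random access machine with unit-cost addition and subtraction of natural numbers. -/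

import Mathlib

/- Graphs: interval graphs, linear and centered colorings. -/

/-- `G` is an interval graph: its vertices are mapped injectively to (closed, nonempty) intervals
of the real line so that distinct vertices are adjacent iff their intervals overlap. -/
def IsIntervalGraph {V : Type*} (G : SimpleGraph V) : Prop :=
  ∃ f : V → NonemptyInterval ℝ, Function.Injective f ∧
    ∀ u v : V, G.Adj u v ↔ u ≠ v ∧ ((f u : Set ℝ) ∩ (f v : Set ℝ)).Nonempty

/-- Some vertex of `S` is a center, that is, its color appears exactly once in `S`. -/
def HasCenter {V C : Type*} (φ : V → C) (S : Set V) : Prop :=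
  ∃ v ∈ S, ∀ u ∈ S, φ u = φ v → u = v

/-- A linear coloring: every path of `G` (induced or not) has a center. -/
def IsLinearColoring {V C : Type*} (G : SimpleGraph V) (ψ : V → C) : Prop :=
  ∀ (u v : V) (p : G.Walk u v), p.IsPath → HasCenter ψ {x | x ∈ p.support}

/-- A centered coloring: every connected subgraph of `G` has a center. -/
def IsCenteredColoring {V C : Type*} (G : SimpleGraph V) (φ : V → C) : Prop :=
  ∀ H : G.Subgraph, H.Connected → HasCenter φ H.verts

/- The machine model: structured programs for a random access machine. The memory consists of
registers and arrays (with statically named arrays) of natural numbers; the arithmetic is addition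
and truncated subtraction, both at unit cost. There is no multiplication, so that a step lengthens
the binary representation of the largest number in memory by only a constant number of bits, and
running time here is polynomially related to running time on a Turing machine. -/

namespace RAM

/-- Memory contents: `reg x` is the register `x`, `arr a i` is the entry `i` of the array `a`. -/
structure State where
  reg : ℕ → ℕ
  arr : ℕ → ℕ → ℕ

/-- Expressions: literals, registers, array entries, sums, truncated differences. -/
inductive Expr where
  | lit (c : ℕ)
  | reg (x : ℕ)
  | get (a : ℕ) (i : Expr)
  | add (e₁ e₂ : Expr)
  | sub (e₁ e₂ : Expr)

/-- The value of an expression. -/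
def Expr.eval (s : State) : Expr → ℕ
  | .lit c => c
  | .reg x => s.reg x
  | .get a i => s.arr a (i.eval s)
  | .add e₁ e₂ => e₁.eval s + e₂.eval s
  | .sub e₁ e₂ => e₁.eval s - e₂.eval s

/-- The number of elementary operations needed to evaluate an expression. -/
def Expr.cost : Expr → ℕ
  | .lit _ => 1
  | .reg _ => 1
  | .get _ i => i.cost + 1
  | .add e₁ e₂ => e₁.cost + e₂.cost + 1
  | .sub e₁ e₂ => e₁.cost + e₂.cost + 1

/-- Programs. A test succeeds iff the value of the expression is nonzero. -/
inductive Prog where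
  | skip
  | set (x : ℕ) (e : Expr)
  | put (a : ℕ) (i e : Expr)
  | seq (p q : Prog)
  | ite (e : Expr) (p q : Prog)
  | loop (e : Expr) (p : Prog)

/-- The effect of writing `c` into the register `x`. -/
def State.setReg (s : State) (x c : ℕ) : State :=
  { s with reg := Function.update s.reg x c }

/-- The effect of writing `c` into the entry `i` of the array `a`. -/
def State.setArr (s : State) (a i c : ℕ) : State :=
  { s with arr := Function.update s.arr a (Function.update (s.arr a) i c) }

/-- `Exec p s s' t`: the program `p`, started in the state `s`, halts in the state `s'`
after `t` steps. (`loop e p` repeats `p` while `e` is nonzero.) -/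
inductive Exec : Prog → State → State → ℕ → Prop where
  | skip (s : State) : Exec .skip s s 1
  | set (x : ℕ) (e : Expr) (s : State) :
      Exec (.set x e) s (s.setReg x (e.eval s)) (e.cost + 1)
  | put (a : ℕ) (i e : Expr) (s : State) :
      Exec (.put a i e) s (s.setArr a (i.eval s) (e.eval s)) (i.cost + e.cost + 1)
  | seq {p q : Prog} {s s' s'' : State} {t t' : ℕ} :
      Exec p s s' t → Exec q s' s'' t' → Exec (.seq p q) s s'' (t + t')
  | ite_true {e : Expr} {p q : Prog} {s s' : State} {t : ℕ} :
      e.eval s ≠ 0 → Exec p s s' t → Exec (.ite e p q) s s' (e.cost + 1 + t)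
  | ite_false {e : Expr} {p q : Prog} {s s' : State} {t : ℕ} :
      e.eval s = 0 → Exec q s s' t → Exec (.ite e p q) s s' (e.cost + 1 + t)
  | loop_true {e : Expr} {p : Prog} {s s' s'' : State} {t t' : ℕ} :
      e.eval s ≠ 0 → Exec p s s' t → Exec (.loop e p) s' s'' t' →
      Exec (.loop e p) s s'' (e.cost + 1 + t + t')
  | loop_false {e : Expr} {p : Prog} {s : State} :
      e.eval s = 0 → Exec (.loop e p) s s (e.cost + 1)

/-- Execution is deterministic: final state and running time are determined by the program and
the initial state. -/
theorem Exec.unique {p : Prog} {s s₁ : State} {t₁ : ℕ} (h₁ : Exec p s s₁ t₁) :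
    ∀ {s₂ : State} {t₂ : ℕ}, Exec p s s₂ t₂ → s₁ = s₂ ∧ t₁ = t₂ := by
  induction h₁ with
  | skip s => intro s₂ t₂ h; cases h; exact ⟨rfl, rfl⟩
  | set x e s => intro s₂ t₂ h; cases h; exact ⟨rfl, rfl⟩
  | put a i e s => intro s₂ t₂ h; cases h; exact ⟨rfl, rfl⟩
  | seq _ _ ih ih' =>
    intro s₂ t₂ h
    cases h with
    | seq g g' =>
      obtain ⟨rfl, rfl⟩ := ih g
      obtain ⟨rfl, rfl⟩ := ih' g'
      exact ⟨rfl, rfl⟩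
  | ite_true he _ ih =>
    intro s₂ t₂ h
    cases h with
    | ite_true _ g => obtain ⟨rfl, rfl⟩ := ih g; exact ⟨rfl, rfl⟩
    | ite_false he' _ => exact absurd he' he
  | ite_false he _ ih =>
    intro s₂ t₂ h
    cases h with
    | ite_true he' _ => exact absurd he he'
    | ite_false _ g => obtain ⟨rfl, rfl⟩ := ih g; exact ⟨rfl, rfl⟩
  | loop_true he _ _ ih ih' =>
    intro s₂ t₂ h
    cases h with
    | loop_true _ g g' =>
      obtain ⟨rfl, rfl⟩ := ih g
      obtain ⟨rfl, rfl⟩ := ih' g'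
      exact ⟨rfl, rfl⟩
    | loop_false he' => exact absurd he' he
  | loop_false he =>
    intro s₂ t₂ h
    cases h with
    | loop_true he' _ _ => exact absurd he he'
    | loop_false _ => exact ⟨rfl, rfl⟩

open Classical in
/-- The initial memory for a graph `G` on `n` vertices with a coloring `ψ` of size `k`:
register 0 holds `n`, register 1 holds `k`, array 0 holds the adjacency matrix of `G` row by row,
array 1 holds the colors of the vertices, and everything else is 0. -/
noncomputable def input {n k : ℕ} (G : SimpleGraph (Fin n)) (ψ : Fin n → Fin k) : State where
  reg x := if x = 0 then n else if x = 1 then k else 0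
  arr a c :=
    if a = 0 then (if ∃ i j : Fin n, c = (i : ℕ) * n + (j : ℕ) ∧ G.Adj i j then 1 else 0)
    else if a = 1 then (if h : c < n then (ψ ⟨c, h⟩ : ℕ) else 0)
    else 0

/-- The memory `s` displays the coloring `φ` of size `m` as output: register 2 holds `m` and
array 2 holds the colors of the vertices. -/
def Outputs (s : State) {n m : ℕ} (φ : Fin n → Fin m) : Prop :=
  s.reg 2 = m ∧ ∀ v : Fin n, s.arr 2 (v : ℕ) = (φ v : ℕ)

end RAM

/-! Represent the graph by intervals. A region (a, b) is eliminated by cutting at a position z: the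
intervals inside the region that contain z get colors of their own, and the parts left and right of
z, which no edge joins any more, share one set of colors. Such a recursion (`CutTree`) gives a
centered coloring whose size is its cost. Two things are needed: a cut tree of cost k², and an
algorithm that does at least as well without knowing the representation.

The bound (`EvenRep.cutTree`) is by induction on the maximal load w, the number of intervals at a
position; w ≤ k because overlapping intervals have different colors under ψ. Raising w by one costs
k more colors. Uncovered positions are cut for free, so assume that the region is covered. The
intervals that are essential in some cover, sorted by least witness, form a path
(`EvenRep.exists_path_essential`), so one of them, v, has a color that is unique among them. Spend
one color on v. If the region stays covered without v, the essential intervals have lost a color.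
Otherwise some position was met by v alone and is now a free cut. On both sides the positions of v
have dropped to load w, and what is essential for covering the rest no longer shows the color of v.
After at most k such steps along any branch, only load w remains (`cutTree_of_cover`).

For the algorithm, take a representation with as few positions as possible. There the intervals
through any position form an intersection of two closed neighborhoods, so n² such sets and the empty
set contain all useful cuts. For any two of these sets X i and X j, a table row holds a centered
coloring of the graph without X i and X j, with a bound on the colors in each component. A
relaxation cuts a row by a third set X l. This keeps the rows correct in every graph
(`goodCol_new`): a piece left over by the cut avoids X i, X j and X l, so the colorings of the rows
(i, l) and (l, j) both apply to it, and the one with the smaller bound is taken. Nobody has to know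
on which side of the cut the piece lies. As in the Bellman-Ford algorithm, after t rounds the rows
that belong to regions of length at most t + 1 are at least as good as any cut tree
(`BoundedBy.succ`). The row of the empty set with itself is the output. The program reads only the
graph; ψ serves to bound the result. -/

namespace RAM

/-! ### Counting loops and their running time -/

/-- Programs with counting loops: `iter x b p` runs `p` for `x = 0, …, b - 1`. -/
inductive Stm where
  | skip
  | set (x : ℕ) (e : Expr)
  | put (a : ℕ) (i e : Expr)
  | seq (p q : Stm)
  | ite (e : Expr) (p q : Stm)
  | iter (x b : ℕ) (p : Stm)

namespace Stm

/-- The state after a run. -/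
def run : Stm → State → State
  | skip, s => s
  | set x e, s => s.setReg x (e.eval s)
  | put a i e, s => s.setArr a (i.eval s) (e.eval s)
  | seq p q, s => q.run (p.run s)
  | ite e p q, s => if e.eval s ≠ 0 then p.run s else q.run s
  | iter x b p, s =>
      (fun s' => (p.run s').setReg x ((p.run s').reg x + 1))^[s.reg b] (s.setReg x 0)

/-- Translation to RAM programs. -/
def compile : Stm → Prog
  | skip => .skip
  | set x e => .set x e
  | put a i e => .put a i e
  | seq p q => .seq p.compile q.compile
  | ite e p q => .ite e p.compile q.compile
  | iter x b p => .seq (.set x (.lit 0)) (.loop (.sub (.reg b) (.reg x))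
      (.seq p.compile (.set x (.add (.reg x) (.lit 1)))))

/-- The registers written by a program. -/
def regs : Stm → List ℕ
  | skip => []
  | set x _ => [x]
  | put _ _ _ => []
  | seq p q => p.regs ++ q.regs
  | ite _ p q => p.regs ++ q.regs
  | iter x _ p => x :: p.regs

/-- The arrays written by a program. -/
def arrs : Stm → List ℕ
  | skip => []
  | set _ _ => []
  | put a _ _ => [a]
  | seq p q => p.arrs ++ q.arrs
  | ite _ p q => p.arrs ++ q.arrs
  | iter _ _ p => p.arrs

/-- The bounds of the loops belong to `B`, no program writes into `B`, and no loop changes its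
own counter. -/
def ok (B : List ℕ) : Stm → Bool
  | skip => true
  | set x _ => !B.contains x
  | put _ _ _ => true
  | seq p q => p.ok B && q.ok B
  | ite _ p q => p.ok B && q.ok B
  | iter x b p => !B.contains x && B.contains b && !p.regs.contains x && p.ok B

/-- A bound for the running time when the loop bounds are at most the argument. -/
noncomputable def time : Stm → Polynomial ℕ
  | skip => 1
  | set _ e => .C (e.cost + 1)
  | put _ i e => .C (i.cost + e.cost + 1)
  | seq p q => p.time + q.time
  | ite e p q => .C (e.cost + 1) + p.time + q.time
  | iter _ _ p => .X * (p.time + .C 8) + .C 6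

theorem run_reg_of_notMem (p : Stm) : ∀ (s : State) {y : ℕ}, y ∉ p.regs →
    (p.run s).reg y = s.reg y := by
  induction p with
  | skip => intro s y _; rfl
  | set x e =>
    intro s y h
    have : y ≠ x := by simpa [regs] using h
    simp [run, State.setReg, Function.update, this]
  | put a i e => intro s y _; rfl
  | seq p q hp hq =>
    intro s y h
    simp only [regs, List.mem_append, not_or] at h
    rw [run, hq _ h.2, hp _ h.1]
  | ite e p q hp hq =>
    intro s y h
    simp only [regs, List.mem_append, not_or] at h
    rw [run]; split_ifs
    · exact hp _ h.1
    · exact hq _ h.2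
  | iter x b p hp =>
    intro s y h
    simp only [regs, List.mem_cons, not_or] at h
    rw [run]
    generalize s.reg b = m
    induction m with
    | zero => simp [State.setReg, Function.update, h.1]
    | succ m ih =>
      rw [Function.iterate_succ_apply']
      simp only [State.setReg, Function.update, h.1, dif_neg, not_false_eq_true]
      rw [hp _ h.2]
      exact ih

theorem run_arr_of_notMem (p : Stm) : ∀ (s : State) {a : ℕ}, a ∉ p.arrs →
    (p.run s).arr a = s.arr a := by
  induction p with
  | skip => intro s y _; rfl
  | set x e => intro s y _; rfl
  | put a i e =>
    intro s y h
    have : y ≠ a := by simpa [arrs] using h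
    simp [run, State.setArr, Function.update, this]
  | seq p q hp hq =>
    intro s y h
    simp only [arrs, List.mem_append, not_or] at h
    rw [run, hq _ h.2, hp _ h.1]
  | ite e p q hp hq =>
    intro s y h
    simp only [arrs, List.mem_append, not_or] at h
    rw [run]; split_ifs
    · exact hp _ h.1
    · exact hq _ h.2
  | iter x b p hp =>
    intro s y h
    rw [run]
    generalize s.reg b = m
    induction m with
    | zero => rfl
    | succ m ih =>
      rw [Function.iterate_succ_apply']
      exact (hp _ h).trans ih

/-- The states agree outside the registers `rs` and the arrays `as`. -/
structure _root_.RAM.Agree (rs as : List ℕ) (s s' : State) : Prop where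
  reg : ∀ y, y ∉ rs → s'.reg y = s.reg y
  arr : ∀ a, a ∉ as → s'.arr a = s.arr a

theorem run_agree (p : Stm) (s : State) : Agree p.regs p.arrs s (p.run s) :=
  ⟨fun _ h => run_reg_of_notMem p s h, fun _ h => run_arr_of_notMem p s h⟩

theorem notMem_regs_of_ok {B : List ℕ} (p : Stm) (h : p.ok B = true) {b : ℕ} (hb : b ∈ B) :
    b ∉ p.regs := by
  induction p with
  | skip => simp [regs]
  | set x e =>
    simp only [ok, Bool.not_eq_true', List.contains_eq_mem, decide_eq_false_iff_not] at h
    simp only [regs, List.mem_singleton]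
    rintro rfl; exact h hb
  | put a i e => simp [regs]
  | seq p q hp hq =>
    simp only [ok, Bool.and_eq_true] at h
    simp [regs, hp h.1, hq h.2]
  | ite e p q hp hq =>
    simp only [ok, Bool.and_eq_true] at h
    simp [regs, hp h.1, hq h.2]
  | iter x c p hp =>
    simp only [ok, Bool.and_eq_true, Bool.not_eq_true', List.contains_eq_mem,
      decide_eq_false_iff_not] at h
    simp only [regs, List.mem_cons, not_or]
    exact ⟨by rintro rfl; exact h.1.1.1 hb, hp h.2⟩

/-- The loop bounds lie in registers that no statement writes, so they stay at most W throughout,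
and since a loop body leaves its counter alone, the test b - x vanishes after exactly as many passes
as the bound says. -/
theorem exec_compile {B : List ℕ} (p : Stm) (h : p.ok B = true) (W : ℕ) :
    ∀ s : State, (∀ b ∈ B, s.reg b ≤ W) →
      ∃ t, Exec p.compile s (p.run s) t ∧ t ≤ p.time.eval W := by
  induction p with
  | skip => intro s _; exact ⟨_, .skip s, by simp [time]⟩
  | set x e => intro s _; exact ⟨_, .set x e s, by simp [time]⟩
  | put a i e => intro s _; exact ⟨_, .put a i e s, by simp [time]⟩
  | seq p q hp hq =>
    intro s hs
    simp only [ok, Bool.and_eq_true] at h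
    obtain ⟨t, e, ht⟩ := hp h.1 s hs
    obtain ⟨t', e', ht'⟩ := hq h.2 (p.run s) fun b hb => by
      rw [run_reg_of_notMem p s (notMem_regs_of_ok p h.1 hb)]; exact hs b hb
    exact ⟨_, .seq e e', by simp only [time, Polynomial.eval_add]; omega⟩
  | ite e p q hp hq =>
    intro s hs
    simp only [ok, Bool.and_eq_true] at h
    obtain ⟨t, f, ht⟩ := hp h.1 s hs
    obtain ⟨t', f', ht'⟩ := hq h.2 s hs
    by_cases he : e.eval s = 0
    · refine ⟨e.cost + 1 + t', ?_, ?_⟩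
      · rw [run, if_neg (by simpa using he)]
        exact .ite_false he f'
      · simp only [time, Polynomial.eval_add, Polynomial.eval_C]; omega
    · refine ⟨e.cost + 1 + t, ?_, ?_⟩
      · rw [run, if_pos he]
        exact .ite_true he f
      · simp only [time, Polynomial.eval_add, Polynomial.eval_C]; omega
  | iter x b p hp =>
    intro s hs
    have hpb : ∀ c ∈ B, c ∉ p.regs := fun c hc => notMem_regs_of_ok p (by
      simp only [ok, Bool.and_eq_true] at h; exact h.2) hc
    simp only [ok, Bool.and_eq_true, Bool.not_eq_true', List.contains_eq_mem,
      decide_eq_false_iff_not, decide_eq_true_eq] at h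
    obtain ⟨⟨⟨hxB, hbB⟩, hxp⟩, hok⟩ := h
    -- A pass costs 3 + 1 for the test and 3 + 1 for the increment besides the body; the last,
    -- failing test costs 4. Setting the counter to 0 adds the 2 that makes 6 in `time`.
    have key : ∀ (m : ℕ) (s : State), (∀ c ∈ B, s.reg c ≤ W) → s.reg b - s.reg x = m →
        ∃ t, Exec (.loop (.sub (.reg b) (.reg x))
          (.seq p.compile (.set x (.add (.reg x) (.lit 1))))) s
          ((fun s' => (p.run s').setReg x ((p.run s').reg x + 1))^[m] s) t ∧
          t ≤ m * (p.time.eval W + 8) + 4 := by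
      intro m
      induction m with
      | zero =>
        intro s _ hm
        exact ⟨_, .loop_false (by simpa [Expr.eval] using hm), by simp [Expr.cost]⟩
      | succ m ih =>
        intro s hs hm
        obtain ⟨t, e, ht⟩ := hp hok s hs
        have hxb : x ≠ b := by rintro rfl; exact hxB hbB
        have hx : (p.run s).reg x = s.reg x := run_reg_of_notMem p s hxp
        obtain ⟨t', e', ht'⟩ := ih ((p.run s).setReg x ((p.run s).reg x + 1))
          (fun c hc => by
            have : c ≠ x := by rintro rfl; exact hxB hc
            simp only [State.setReg, Function.update, this, dif_neg, not_false_eq_true]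
            rw [run_reg_of_notMem p s (hpb c hc)]; exact hs c hc)
          (by
            simp only [State.setReg, Function.update_self, Function.update_of_ne hxb.symm]
            rw [hx, run_reg_of_notMem p s (hpb b hbB)]; omega)
        refine ⟨3 + 1 + (t + (3 + 1)) + t', ?_, ?_⟩
        · rw [Function.iterate_succ_apply]
          exact .loop_true (by simp [Expr.eval, hm]) (.seq e (.set _ _ _)) e'
        · have : (m + 1) * (p.time.eval W + 8) = m * (p.time.eval W + 8) + p.time.eval W + 8 := by
            ring
          omega
    obtain ⟨t, e, ht⟩ := key (s.reg b) (s.setReg x 0) (fun c hc => by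
        have : c ≠ x := by rintro rfl; exact hxB hc
        simpa [State.setReg, Function.update, this] using hs c hc) (by
        have hxb : b ≠ x := by rintro rfl; exact hxB hbB
        simp [State.setReg, Function.update_of_ne hxb])
    refine ⟨_, .seq (.set _ _ _) e, ?_⟩
    simp only [time, Polynomial.eval_add, Polynomial.eval_mul, Polynomial.eval_X,
      Polynomial.eval_C, Expr.cost]
    have := Nat.mul_le_mul_right (p.time.eval W + 8) (hs b hbB)
    omega

/-- The invariant rule for counting loops. -/
theorem run_iter {x b : ℕ} {p : Stm} {s : State} (I : ℕ → State → Prop)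
    (hx : x ∉ p.regs) (h0 : I 0 (s.setReg x 0))
    (hI : ∀ i < s.reg b, ∀ s' : State, s'.reg x = i → Agree (x :: p.regs) p.arrs s s' → I i s' →
      I (i + 1) ((p.run s').setReg x (i + 1))) :
    I (s.reg b) ((iter x b p).run s) := by
  rw [run]
  have : ∀ m ≤ s.reg b,
      let s'' := (fun s' => (p.run s').setReg x ((p.run s').reg x + 1))^[m] (s.setReg x 0)
      s''.reg x = m ∧ Agree (x :: p.regs) p.arrs s s'' ∧ I m s'' := by
    intro m
    induction m with
    | zero =>
      intro _
      refine ⟨by simp [State.setReg], ⟨fun y hy => ?_, fun _ _ => rfl⟩, h0⟩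
      simp only [List.mem_cons, not_or] at hy
      exact Function.update_of_ne hy.1 _ _
    | succ m ih =>
      intro hm
      obtain ⟨h1, h2, h3⟩ := ih (by omega)
      simp only [Function.iterate_succ_apply'] at *
      generalize (fun s' => (p.run s').setReg x ((p.run s').reg x + 1))^[m] (s.setReg x 0) = s'
        at *
      have h4 := run_reg_of_notMem p s' hx
      refine ⟨by simp [State.setReg, h4, h1], ⟨fun y hy => ?_, fun a ha => ?_⟩, ?_⟩
      · rw [← h2.reg y hy]
        simp only [List.mem_cons, not_or] at hy
        exact (Function.update_of_ne hy.1 _ _).trans (run_reg_of_notMem p s' hy.2)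
      · exact (run_arr_of_notMem p s' ha).trans (h2.arr a ha)
      · have := hI m (by omega) s' h1 h2 h3
        rwa [h4, h1]
  exact (this _ le_rfl).2.2

end Stm

end RAM

/-! ### Cut trees -/

/-- The vertices of `F` in the open region `(a, b)` can be eliminated at a cost of at most `m` by
repeatedly cutting at positions. -/
inductive CutTree {V : Type*} [DecidableEq V] (L R : V → ℕ) (F : Finset V) : ℕ → ℕ → ℕ → Prop
  | empty {a b m : ℕ} (h : ∀ v ∈ F, ¬(a < L v ∧ R v < b)) : CutTree L R F a b m
  | cut {a b m m' : ℕ} (z : ℕ) (haz : a < z) (hzb : z < b) (h₁ : CutTree L R F a z m')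
      (h₂ : CutTree L R F z b m')
      (h : (F.filter fun v => a < L v ∧ L v ≤ z ∧ z ≤ R v ∧ R v < b).card + m' ≤ m) :
      CutTree L R F a b m

namespace CutTree

variable {V : Type*} [DecidableEq V] {L R : V → ℕ} {F F' : Finset V} {a b m m' : ℕ}

theorem mono (h : CutTree L R F a b m) (hm : m ≤ m') : CutTree L R F a b m' := by
  cases h with
  | empty h => exact .empty h
  | cut z haz hzb h₁ h₂ h => exact .cut z haz hzb h₁ h₂ (h.trans hm)

/-- Only the intervals inside the region matter, so the family may be changed freely outside. -/
theorem of_agree (h : CutTree L R F a b m)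
    (hF : ∀ v, a < L v → R v < b → v ∈ F' → v ∈ F) : CutTree L R F' a b m := by
  induction h with
  | empty h => exact .empty fun v hv h' => h v (hF v h'.1 h'.2 hv) h'
  | @cut a b m m' z haz hzb h₁ h₂ h ih₁ ih₂ =>
    refine .cut z haz hzb (ih₁ fun v h1 h2 => hF v h1 (h2.trans hzb))
      (ih₂ fun v h1 h2 => hF v (haz.trans h1) h2)
      (le_trans (Nat.add_le_add_right (Finset.card_le_card fun v hv => ?_) m') h)
    simp only [Finset.mem_filter] at hv ⊢
    exact ⟨hF v hv.2.1 hv.2.2.2.2 hv.1, hv.2⟩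

/-- Follow v down the tree to the first cut that meets it, where it costs one more color. The two
sides of a cut share their colors, so this one color is paid only once. -/
theorem of_erase (hLR : ∀ v, L v ≤ R v) {v : V} (h : CutTree L R (F.erase v) a b m) :
    CutTree L R F a b (m + 1) := by
  by_cases hv : a < L v ∧ R v < b
  swap
  · refine (h.of_agree fun u h1 h2 hu => ?_).mono (Nat.le_succ m)
    exact Finset.mem_erase.2 ⟨by rintro rfl; exact hv ⟨h1, h2⟩, hu⟩
  generalize hE : F.erase v = E at h
  induction h with
  -- No cut has met v and no other interval is left in its region, so an additional cut at L v
  -- removes it.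
  | @empty a b m h =>
    subst hE
    have := hLR v
    refine .cut (m' := m) (L v) hv.1 (by omega) (.empty ?_) (.empty ?_) ?_
    · intro u hu h'
      refine h u (Finset.mem_erase.2 ⟨?_, hu⟩) ⟨h'.1, by omega⟩
      rintro rfl; omega
    · intro u hu h'
      refine h u (Finset.mem_erase.2 ⟨?_, hu⟩) ⟨by omega, h'.2⟩
      rintro rfl; omega
    · have : (F.filter fun u => a < L u ∧ L u ≤ L v ∧ L v ≤ R u ∧ R u < b) ⊆ {v} := by
        intro u hu
        simp only [Finset.mem_filter] at hu
        by_contra hne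
        exact h u (Finset.mem_erase.2 ⟨by simpa using hne, hu.1⟩) ⟨hu.2.1, hu.2.2.2.2⟩
      have := Finset.card_le_card this
      simp at this
      omega
  | @cut a b m m' z haz hzb h₁ h₂ h ih₁ ih₂ =>
    subst hE
    have hvc : v ∉ F.erase v := by simp
    by_cases hz : L v ≤ z ∧ z ≤ R v
    · refine .cut z haz hzb (h₁.of_agree ?_) (h₂.of_agree ?_) (m' := m') ?_
      · intro u h1 h2 hu
        exact Finset.mem_erase.2 ⟨by rintro rfl; omega, hu⟩
      · intro u h1 h2 hu
        exact Finset.mem_erase.2 ⟨by rintro rfl; omega, hu⟩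
      · have : (F.filter fun u => a < L u ∧ L u ≤ z ∧ z ≤ R u ∧ R u < b) ⊆
            insert v ((F.erase v).filter fun u => a < L u ∧ L u ≤ z ∧ z ≤ R u ∧ R u < b) := by
          intro u hu
          simp only [Finset.mem_filter, Finset.mem_insert, Finset.mem_erase] at hu ⊢
          tauto
        have := (Finset.card_le_card this).trans (Finset.card_insert_le _ _)
        omega
    · have hcard : (F.filter fun u => a < L u ∧ L u ≤ z ∧ z ≤ R u ∧ R u < b).card + (m' + 1)
          ≤ m + 1 := by
        have : (F.filter fun u => a < L u ∧ L u ≤ z ∧ z ≤ R u ∧ R u < b) ⊆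
            (F.erase v).filter fun u => a < L u ∧ L u ≤ z ∧ z ≤ R u ∧ R u < b := by
          intro u hu
          simp only [Finset.mem_filter, Finset.mem_erase] at hu ⊢
          refine ⟨⟨?_, hu.1⟩, hu.2⟩
          rintro rfl; exact hz ⟨hu.2.2.1, hu.2.2.2.1⟩
        have := Finset.card_le_card this
        omega
      have := hLR v
      rcases Nat.lt_or_ge (R v) z with h' | h'
      · refine .cut z haz hzb (ih₁ ⟨hv.1, h'⟩) ((h₂.of_agree ?_).mono (Nat.le_succ _)) hcard
        intro u h1 h2 hu
        exact Finset.mem_erase.2 ⟨by rintro rfl; omega, hu⟩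
      · refine .cut z haz hzb ((h₁.of_agree ?_).mono (Nat.le_succ _)) (ih₂ ⟨by omega, hv.2⟩)
          hcard
        intro u h1 h2 hu
        exact Finset.mem_erase.2 ⟨by rintro rfl; omega, hu⟩

end CutTree

/-! ### Essential intervals and the path they form -/

/-- `v` is essential in some cover of the positions `α, …, β` by members of `F`, as the only one
that covers `z`. -/
def IsWitness {V : Type*} (L R : V → ℕ) (F : Finset V) (α β : ℕ) (v : V) (z : ℕ) : Prop :=
  α ≤ z ∧ z ≤ β ∧ L v ≤ z ∧ z ≤ R v ∧ ∃ C ⊆ F, (∀ u ∈ C, ¬(L u ≤ z ∧ z ≤ R u)) ∧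
    ∀ p, α ≤ p → p ≤ β → (L v ≤ p ∧ p ≤ R v) ∨ ∃ u ∈ C, L u ≤ p ∧ p ≤ R u

open Classical in
/-- The members of `F` that are essential in some cover of the positions `α, …, β`. -/
noncomputable def essential {V : Type*} (L R : V → ℕ) (F : Finset V) (α β : ℕ) : Finset V :=
  F.filter fun v => ∃ z, IsWitness L R F α β v z

theorem mem_essential {V : Type*} {L R : V → ℕ} {F : Finset V} {α β : ℕ} {v : V} :
    v ∈ essential L R F α β ↔ v ∈ F ∧ ∃ z, IsWitness L R F α β v z := by
  simp [essential]

/-- A list without repetitions, with consecutive entries adjacent, is the support of a path. -/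
theorem exists_path_of_isChain {V : Type*} {G : SimpleGraph V} (x : V) (l : List V)
    (h : (x :: l).IsChain G.Adj) :
    ∃ (y : V) (p : G.Walk x y), p.support = x :: l := by
  induction l generalizing x with
  | nil => exact ⟨x, .nil, rfl⟩
  | cons y l ih =>
    rw [List.isChain_cons_cons] at h
    obtain ⟨z, p, hp⟩ := ih y h.2
    exact ⟨z, .cons h.1 p, by simp [hp]⟩

/-- A discrete interval representation with even endpoints. -/
structure EvenRep {V : Type*} (G : SimpleGraph V) (L R : V → ℕ) : Prop where
  le : ∀ v, L v ≤ R v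
  evenL : ∀ v, Even (L v)
  evenR : ∀ v, Even (R v)
  adj : ∀ u v, G.Adj u v ↔ u ≠ v ∧ L u ≤ R v ∧ L v ≤ R u

/-- The number of members of `F` at the position `p`. -/
def load {V : Type*} (L R : V → ℕ) (F : Finset V) (p : ℕ) : ℕ := (F.filter fun v => L v ≤ p ∧ p ≤ R v).card

theorem load_mono {V : Type*} {L R : V → ℕ} {F F' : Finset V} (h : F' ⊆ F) (p : ℕ) : load L R F' p ≤ load L R F p :=
  Finset.card_le_card (Finset.filter_subset_filter _ h)

section

variable {V : Type*} [DecidableEq V] {G : SimpleGraph V} {L R : V → ℕ}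

/-- The gap just right of u must be covered by other members in the cover belonging to u. The one
among them that reaches farthest to the right can replace the others, which makes it essential at
the gap. -/
theorem EvenRep.exists_between (hG : EvenRep G L R) {F : Finset V} {α β : ℕ}
    {u v : V} {zu zv : ℕ} (hu : u ∈ F) (hzu : IsWitness L R F α β u zu)
    (hzv : IsWitness L R F α β v zv) (hlt : zu < zv) (huv : u ≠ v) (hadj : ¬G.Adj u v) :
    ∃ w ∈ F, ∃ z, IsWitness L R F α β w z ∧ z < zv ∧ zu < L w := by
  obtain ⟨h1, h2, h3, h4, C, hCF, hC, hcov⟩ := hzu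
  have hRL : R u < L v := by
    by_contra hcon
    apply hadj
    rw [hG.adj]
    have := hzv.2.2.2.1
    exact ⟨huv, by omega, by omega⟩
  obtain ⟨r, hr⟩ := hG.evenR u
  obtain ⟨l, hl⟩ := hG.evenL v
  have hg : R u + 1 < L v := by omega
  have hzvL := hzv.2.2.1
  have hzvβ := hzv.2.1
  -- As endpoints are even, the odd position g lies strictly between u and v and meets neither.
  set g := R u + 1 with hgdef
  have hne : (C.filter fun x => L x ≤ g ∧ g ≤ R x).Nonempty := by
    rcases hcov g (by omega) (by omega) with h | ⟨w, hw, h⟩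
    · omega
    · exact ⟨w, by simp [hw, h]⟩
  obtain ⟨w, hw, hmax⟩ := Finset.exists_max_image _ R hne
  simp only [Finset.mem_filter] at hw hmax
  have hwz := hC w hw.1
  -- The members of C dropped here contain g but not zu: left of g their positions belong to u, and
  -- from g on to w, by the maximality of R w.
  refine ⟨w, hCF hw.1, g, ⟨by omega, by omega, hw.2.1, hw.2.2,
    insert u (C.filter fun x => R x < g ∨ g < L x), ?_, ?_, ?_⟩, by omega, by omega⟩
  · intro x hx
    simp only [Finset.mem_insert, Finset.mem_filter] at hx
    rcases hx with rfl | hx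
    · exact hu
    · exact hCF hx.1
  · intro x hx
    simp only [Finset.mem_insert, Finset.mem_filter] at hx
    rcases hx with rfl | hx
    · omega
    · omega
  · intro p hp1 hp2
    simp only [Finset.mem_insert, Finset.mem_filter]
    rcases hcov p hp1 hp2 with h | ⟨x, hx, h⟩
    · exact .inr ⟨u, .inl rfl, h⟩
    · have hxz := hC x hx
      by_cases hxg : R x < g ∨ g < L x
      · exact .inr ⟨x, .inr ⟨hx, hxg⟩, h⟩
      · by_cases hpu : p ≤ R u
        · exact .inr ⟨u, .inl rfl, by omega, hpu⟩
        · have := hmax x ⟨hx, by omega⟩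
          exact .inl ⟨by omega, by omega⟩

/-- The essential vertices are the vertices of a path. -/
theorem EvenRep.exists_path_essential (hG : EvenRep G L R) (F : Finset V) (α β : ℕ)
    (hne : (essential L R F α β).Nonempty) :
    ∃ (x y : V) (p : G.Walk x y), p.IsPath ∧ ∀ v, v ∈ p.support ↔ v ∈ essential L R F α β := by
  classical
  -- The least witness of an essential vertex; the value 0 elsewhere plays no role.
  let key : V → ℕ := fun v => if h : ∃ z, IsWitness L R F α β v z then Nat.find h else 0
  have hkey : ∀ v ∈ essential L R F α β, IsWitness L R F α β v (key v) := by
    intro v hv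
    have h := (mem_essential.1 hv).2
    simp only [key, dif_pos h]
    exact Nat.find_spec h
  have hmin : ∀ v z, IsWitness L R F α β v z → key v ≤ z := by
    intro v z hz
    have h : ∃ z, IsWitness L R F α β v z := ⟨z, hz⟩
    simp only [key, dif_pos h]
    exact Nat.find_min' h hz
  let l := (essential L R F α β).toList.insertionSort fun u v => key u ≤ key v
  have : Std.Total fun u v : V => key u ≤ key v := ⟨fun u v => le_total _ _⟩
  have : IsTrans V fun u v => key u ≤ key v := ⟨fun u v w => le_trans⟩
  have hmem : ∀ v, v ∈ l ↔ v ∈ essential L R F α β := by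
    intro v; simp [l, List.mem_insertionSort]
  have hsort : l.Pairwise fun u v => key u ≤ key v := List.pairwise_insertionSort _ _
  have hnd : l.Nodup := by
    have := (List.perm_insertionSort (fun u v => key u ≤ key v)
      (essential L R F α β).toList).nodup_iff
    exact this.2 (Finset.nodup_toList _)
  have hchain : l.IsChain G.Adj := by
    rw [List.isChain_iff_forall_rel_of_append_cons_cons]
    intro u v l₁ l₂ hl
    have hu := (hmem u).1 (by rw [hl]; simp)
    have hv := (hmem v).1 (by rw [hl]; simp)
    have huv : u ≠ v := by
      rintro rfl
      rw [hl, List.nodup_append] at hnd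
      simp at hnd
    rw [hl, List.pairwise_append] at hsort
    obtain ⟨-, hs2, hs1⟩ := hsort
    rw [List.pairwise_cons, List.pairwise_cons] at hs2
    have hle := hs2.1 v (by simp)
    have hwu := hkey u hu
    have hwv := hkey v hv
    rcases hle.eq_or_lt with heq | hlt
    · rw [hG.adj]
      have h1 := hwu.2.2.1
      have h2 := hwu.2.2.2.1
      have h3 := hwv.2.2.1
      have h4 := hwv.2.2.2.1
      exact ⟨huv, by omega, by omega⟩
    -- Otherwise a third essential vertex has its least witness strictly between those of two
    -- consecutive entries of the sorted list.
    · by_contra hadj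
      obtain ⟨w, hwF, z, hz, hzv, hLw⟩ :=
        hG.exists_between ((mem_essential.1 hu).1) hwu hwv hlt huv hadj
      have hw : w ∈ essential L R F α β := mem_essential.2 ⟨hwF, z, hz⟩
      have h1 : key w < key v := (hmin w z hz).trans_lt hzv
      have h2 : key u < key w := hLw.trans_le (hkey w hw).2.2.1
      have hwl := (hmem w).2 hw
      rw [hl] at hwl
      simp only [List.mem_append, List.mem_cons] at hwl
      rcases hwl with h | rfl | rfl | h
      · have := hs1 w h u (by simp); omega
      · omega
      · omega
      · have := hs2.2.1 w h; omega
  have hl0 : l ≠ [] := by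
    obtain ⟨v, hv⟩ := hne
    intro h
    have := (hmem v).2 hv
    simp [h] at this
  obtain ⟨x, l', hl'⟩ := List.exists_cons_of_ne_nil hl0
  rw [hl'] at hchain hnd
  obtain ⟨y, p, hp⟩ := exists_path_of_isChain x l' hchain
  refine ⟨x, y, p, ?_, fun v => ?_⟩
  · rw [SimpleGraph.Walk.isPath_def, hp]; exact hnd
  · rw [hp, ← hl', hmem]

/-- This is a center of the path of essential vertices. There are essential vertices at all because
every member of an inclusion-minimal cover is one. -/
theorem EvenRep.exists_unique_color {k : ℕ} (hG : EvenRep G L R) {ψ : V → Fin k}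
    (hψ : IsLinearColoring G ψ) {F : Finset V} {α β : ℕ} (hαβ : α ≤ β)
    (hcov : ∀ p, α ≤ p → p ≤ β → ∃ v ∈ F, L v ≤ p ∧ p ≤ R v) :
    ∃ v ∈ essential L R F α β, ∀ u ∈ essential L R F α β, ψ u = ψ v → u = v := by
  have hne : (essential L R F α β).Nonempty := by
    obtain ⟨v, hv, hv'⟩ := hcov α le_rfl hαβ
    let P : Finset V → Prop := fun C => ∀ p, α ≤ p → p ≤ β → ∃ v ∈ C, L v ≤ p ∧ p ≤ R v
    obtain ⟨C, hCF, hC⟩ := exists_minimal_le_of_wellFoundedLT P F hcov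
    obtain ⟨v, hv, -⟩ := hC.prop α le_rfl hαβ
    have hnot : ¬P (C.erase v) := fun h => by
      have := hC.le_of_le h (Finset.erase_subset _ _)
      exact Finset.notMem_erase v C (this hv)
    simp only [P] at hnot
    push Not at hnot
    obtain ⟨z, hz1, hz2, hz⟩ := hnot
    refine ⟨v, mem_essential.2 ⟨hCF hv, z, hz1, hz2, ?_⟩⟩
    have hvz : L v ≤ z ∧ z ≤ R v := by
      obtain ⟨u, hu, hu'⟩ := hC.prop z hz1 hz2
      by_cases huv : u = v
      · exact huv ▸ hu'
      · have := hz u (Finset.mem_erase.2 ⟨huv, hu⟩) hu'.1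
        omega
    refine ⟨hvz.1, hvz.2, C.erase v, (Finset.erase_subset _ _).trans hCF, ?_, ?_⟩
    · intro u hu hu'
      have := hz u hu hu'.1
      omega
    · intro p hp1 hp2
      obtain ⟨u, hu, hu'⟩ := hC.prop p hp1 hp2
      by_cases huv : u = v
      · exact .inl (huv ▸ hu')
      · exact .inr ⟨u, Finset.mem_erase.2 ⟨huv, hu⟩, hu'⟩
  obtain ⟨x, y, p, hp, hmem⟩ := hG.exists_path_essential F α β hne
  obtain ⟨v, hv, h⟩ := hψ x y p hp
  exact ⟨v, (hmem v).1 hv, fun u hu => h u ((hmem u).2 hu)⟩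

theorem essential_erase_subset {F : Finset V} {α β : ℕ} {v : V} :
    essential L R (F.erase v) α β ⊆ (essential L R F α β).erase v := by
  intro u hu
  obtain ⟨hu, z, h1, h2, h3, h4, C, hC, h⟩ := mem_essential.1 hu
  rw [Finset.mem_erase] at hu
  exact Finset.mem_erase.2 ⟨hu.1, mem_essential.2 ⟨hu.2, z, h1, h2, h3, h4, C,
    hC.trans (Finset.erase_subset _ _), h⟩⟩

/-- A cover of the part left of v extends to the whole range by adding v and the members right of p,
because only v passes p. The added members miss the old witness, which therefore remains a witness.
-/
theorem essential_left_subset {F : Finset V} {α β : ℕ} {v : V} {p : ℕ} (hv : v ∈ F)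
    (hα : α < L v)     (hvp : L v ≤ p ∧ p ≤ R v) (hpβ : p ≤ β)
    (hcov : ∀ p, α ≤ p → p ≤ β → ∃ v ∈ F, L v ≤ p ∧ p ≤ R v)
    (hp : ∀ u ∈ F, u ≠ v → ¬(L u ≤ p ∧ p ≤ R u)) :
    essential L R (F.filter fun u => R u < p) α (L v - 1) ⊆ (essential L R F α β).erase v := by
  intro u hu
  obtain ⟨hu, z, h1, h2, h3, h4, C, hC, hCz, hCc⟩ := mem_essential.1 hu
  rw [Finset.mem_filter] at hu
  refine Finset.mem_erase.2 ⟨by rintro rfl; omega, mem_essential.2 ⟨hu.1, z, h1, by omega, h3, h4,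
    insert v (C ∪ F.filter fun u => p < L u), ?_, ?_, ?_⟩⟩
  · intro x hx
    simp only [Finset.mem_insert, Finset.mem_union, Finset.mem_filter] at hx
    rcases hx with rfl | hx | hx
    · exact hv
    · exact Finset.filter_subset _ _ (hC hx)
    · exact hx.1
  · intro x hx
    simp only [Finset.mem_insert, Finset.mem_union, Finset.mem_filter] at hx
    rcases hx with rfl | hx | hx
    · omega
    · exact hCz x hx
    · omega
  · intro q hq1 hq2
    simp only [Finset.mem_insert, Finset.mem_union, Finset.mem_filter]
    by_cases hqv : q < L v
    · rcases hCc q hq1 (by omega) with h | ⟨x, hx, h⟩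
      · exact .inl h
      · exact .inr ⟨x, .inr (.inl hx), h⟩
    · by_cases hqv' : q ≤ R v
      · exact .inr ⟨v, .inl rfl, by omega, hqv'⟩
      · obtain ⟨x, hx, h⟩ := hcov q hq1 hq2
        have := hp x hx (by rintro rfl; omega)
        exact .inr ⟨x, .inr (.inr ⟨hx, by omega⟩), h⟩

theorem essential_right_subset {F : Finset V} {α β : ℕ} {v : V} {p : ℕ} (hv : v ∈ F)
    (hvp : L v ≤ p ∧ p ≤ R v) (hpα : α ≤ p)
    (hcov : ∀ p, α ≤ p → p ≤ β → ∃ v ∈ F, L v ≤ p ∧ p ≤ R v)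
    (hp : ∀ u ∈ F, u ≠ v → ¬(L u ≤ p ∧ p ≤ R u)) :
    essential L R (F.filter fun u => p < L u) (R v + 1) β ⊆ (essential L R F α β).erase v := by
  intro u hu
  obtain ⟨hu, z, h1, h2, h3, h4, C, hC, hCz, hCc⟩ := mem_essential.1 hu
  rw [Finset.mem_filter] at hu
  refine Finset.mem_erase.2 ⟨by rintro rfl; omega, mem_essential.2 ⟨hu.1, z, by omega, h2, h3, h4,
    insert v (C ∪ F.filter fun u => R u < p), ?_, ?_, ?_⟩⟩
  · intro x hx
    simp only [Finset.mem_insert, Finset.mem_union, Finset.mem_filter] at hx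
    rcases hx with rfl | hx | hx
    · exact hv
    · exact Finset.filter_subset _ _ (hC hx)
    · exact hx.1
  · intro x hx
    simp only [Finset.mem_insert, Finset.mem_union, Finset.mem_filter] at hx
    rcases hx with rfl | hx | hx
    · omega
    · exact hCz x hx
    · omega
  · intro q hq1 hq2
    simp only [Finset.mem_insert, Finset.mem_union, Finset.mem_filter]
    by_cases hqv : R v < q
    · rcases hCc q (by omega) hq2 with h | ⟨x, hx, h⟩
      · exact .inl h
      · exact .inr ⟨x, .inr (.inl hx), h⟩
    · by_cases hqv' : L v ≤ q
      · exact .inr ⟨v, .inl rfl, hqv', by omega⟩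
      · obtain ⟨x, hx, h⟩ := hcov q hq1 hq2
        have := hp x hx (by rintro rfl; omega)
        exact .inr ⟨x, .inr (.inr ⟨hx, by omega⟩), h⟩

theorem load_erase {F : Finset V} {v : V} (hv : v ∈ F) {p : ℕ} (hp : L v ≤ p ∧ p ≤ R v) :
    load L R (F.erase v) p + 1 = load L R F p := by
  rw [load, load, Finset.filter_erase, Finset.card_erase_add_one]
  simp [hv, hp]

/-! ### The bound k² for cut trees -/

/-- Each step removes an interval of unique color among the essential ones. The range from α to β
contains the positions where the load may still be w + 1, and c bounds the number of colors on the
essential intervals. A step lowers c, and once the range is empty the bound for load w applies. -/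
theorem cutTree_of_cover {k : ℕ} (hG : EvenRep G L R) {ψ : V → Fin k}
    (hψ : IsLinearColoring G ψ) {w : ℕ}
    (ih : ∀ (F : Finset V) (a b : ℕ), (∀ p, a < p → p < b → load L R F p ≤ w) →
      CutTree L R F a b (k * w)) (F : Finset V) :
    ∀ (a b α β c : ℕ), a < α → β < b → ((essential L R F α β).image ψ).card ≤ c →
      (∀ p, α ≤ p → p ≤ β → ∃ v ∈ F, L v ≤ p ∧ p ≤ R v) →
      (∀ p, α ≤ p → p ≤ β → load L R F p ≤ w + 1) →
      (∀ p, a < p → p < b → ¬(α ≤ p ∧ p ≤ β) → load L R F p ≤ w) →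
      CutTree L R F a b (c + k * w) := by
  induction F using Finset.strongInduction with
  | H F IH =>
  intro a b α β c ha hb hc hcov hload hload'
  by_cases hαβ : α ≤ β
  swap
  · exact (ih F a b fun p h1 h2 => hload' p h1 h2 (by omega)).mono (by omega)
  obtain ⟨v, hv, huniq⟩ := hG.exists_unique_color hψ hαβ hcov
  have hvF := (mem_essential.1 hv).1
  have himg : ∀ S ⊆ (essential L R F α β).erase v, (S.image ψ).card + 1 ≤ c := by
    intro S hS
    have : S.image ψ ⊆ ((essential L R F α β).image ψ).erase (ψ v) := by
      intro x hx
      obtain ⟨u, hu, rfl⟩ := Finset.mem_image.1 hx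
      have hu := Finset.mem_erase.1 (hS hu)
      exact Finset.mem_erase.2 ⟨fun h => hu.1 (huniq u hu.2 h), Finset.mem_image_of_mem _ hu.2⟩
    have h1 := Finset.card_le_card this
    have h2 := Finset.card_erase_add_one (Finset.mem_image_of_mem ψ hv)
    omega
  have hc1 : 1 ≤ c := by have := himg ∅ (by simp); omega
  suffices h : CutTree L R (F.erase v) a b (c - 1 + k * w) from
    (h.of_erase hG.le).mono (by omega)
  have hss := Finset.erase_ssubset hvF
  by_cases hbr : ∀ p, α ≤ p → p ≤ β → ∃ u ∈ F.erase v, L u ≤ p ∧ p ≤ R u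
  · refine IH _ hss a b α β _ ha hb ?_ hbr (fun p h1 h2 => ?_) (fun p h1 h2 h3 => ?_)
    · have := himg _ (essential_erase_subset (L := L) (R := R) (F := F) (α := α) (β := β)); omega
    · exact (load_mono hss.subset p).trans (hload p h1 h2)
    · exact (load_mono hss.subset p).trans (hload' p h1 h2 h3)
  -- Some position p of the range is met by v alone, so that without v a cut at p is free.
  · push Not at hbr
    obtain ⟨p, hp1, hp2, hp⟩ := hbr
    have hpu : ∀ u ∈ F, u ≠ v → ¬(L u ≤ p ∧ p ≤ R u) := fun u hu huv h => by
      have := hp u (Finset.mem_erase.2 ⟨huv, hu⟩) h.1; omega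
    have hvp : L v ≤ p ∧ p ≤ R v := by
      obtain ⟨u, hu, h⟩ := hcov p hp1 hp2
      by_cases huv : u = v
      · exact huv ▸ h
      · exact absurd h (hpu u hu huv)
    have hloadv : ∀ q, a < q → q < b → L v ≤ q → q ≤ R v → load L R (F.erase v) q ≤ w := by
      intro q h1 h2 h3 h4
      by_cases hq : α ≤ q ∧ q ≤ β
      · have := load_erase hvF ⟨h3, h4⟩
        have := hload q hq.1 hq.2
        omega
      · exact (load_mono hss.subset q).trans (hload' q h1 h2 hq)
    have hll : (F.filter fun u => R u < p) ⊆ F.erase v := by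
      intro u hu
      rw [Finset.mem_filter] at hu
      exact Finset.mem_erase.2 ⟨by rintro rfl; omega, hu.1⟩
    have hrr : (F.filter fun u => p < L u) ⊆ F.erase v := by
      intro u hu
      rw [Finset.mem_filter] at hu
      exact Finset.mem_erase.2 ⟨by rintro rfl; omega, hu.1⟩
    -- From L v to p the load is at most w after the removal of v. Load w + 1 can remain only
    -- between α and L v - 1, which is nowhere if v reaches down to α.
    have hl : CutTree L R (F.filter fun u => R u < p) a p (c - 1 + k * w) := by
      by_cases hαv : α < L v
      swap
      · refine (ih _ a p fun q h1 h2 => ?_).mono (by omega)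
        by_cases hq : α ≤ q
        · exact (load_mono hll q).trans (hloadv q h1 (by omega) (by omega) (by omega))
        · exact (load_mono (Finset.filter_subset _ _) q).trans
            (hload' q h1 (by omega) (by omega))
      refine IH _ (hll.trans_ssubset hss) a p α (L v - 1) _ ha (by omega) ?_ ?_ ?_ ?_
      · have := himg _ (essential_left_subset hvF hαv hvp hp2 hcov hpu)
        omega
      · intro q h1 h2
        obtain ⟨u, hu, h⟩ := hcov q h1 (by omega)
        have := hpu u hu (by rintro rfl; omega)
        exact ⟨u, Finset.mem_filter.2 ⟨hu, by omega⟩, h⟩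
      · intro q h1 h2
        exact (load_mono (Finset.filter_subset _ _) q).trans (hload q h1 (by omega))
      · intro q h1 h2 h3
        by_cases hq : α ≤ q
        · exact (load_mono hll q).trans (hloadv q h1 (by omega) (by omega) (by omega))
        · exact (load_mono (Finset.filter_subset _ _) q).trans
            (hload' q h1 (by omega) (by omega))
    have hr : CutTree L R (F.filter fun u => p < L u) p b (c - 1 + k * w) := by
      refine IH _ (hrr.trans_ssubset hss) p b (R v + 1) β _ (by omega) hb ?_ ?_ ?_ ?_
      · have := himg _ (essential_right_subset hvF hvp hp1 hcov hpu)
        omega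
      · intro q h1 h2
        obtain ⟨u, hu, h⟩ := hcov q (by omega) h2
        have := hpu u hu (by rintro rfl; omega)
        exact ⟨u, Finset.mem_filter.2 ⟨hu, by omega⟩, h⟩
      · intro q h1 h2
        exact (load_mono (Finset.filter_subset _ _) q).trans (hload q (by omega) h2)
      · intro q h1 h2 h3
        by_cases hq : q ≤ β
        · exact (load_mono hrr q).trans (hloadv q (by omega) h2 (by omega) (by omega))
        · exact (load_mono (Finset.filter_subset _ _) q).trans
            (hload' q (by omega) h2 (by omega))
    refine .cut p (by omega) (by omega) (hl.of_agree ?_) (hr.of_agree ?_)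
      (m' := c - 1 + k * w) ?_
    · intro u _ h2 hu
      exact Finset.mem_filter.2 ⟨Finset.mem_of_mem_erase hu, h2⟩
    · intro u h1 _ hu
      exact Finset.mem_filter.2 ⟨Finset.mem_of_mem_erase hu, h1⟩
    · rw [Finset.card_eq_zero.2, zero_add]
      rw [Finset.filter_eq_empty_iff]
      intro u hu h
      exact hpu u (Finset.mem_of_mem_erase hu) (Finset.ne_of_mem_erase hu) ⟨h.2.1, h.2.2.1⟩

/-- Free cuts at uncovered positions reduce to a covered region; there the essential intervals show
at most k colors, so k is what one unit of load costs. -/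
theorem cutTree_of_load_le {k : ℕ} (hG : EvenRep G L R) {ψ : V → Fin k}
    (hψ : IsLinearColoring G ψ) (w : ℕ) : ∀ (F : Finset V) (a b : ℕ),
    (∀ p, a < p → p < b → load L R F p ≤ w) → CutTree L R F a b (k * w) := by
  induction w with
  | zero =>
    intro F a b h
    refine .empty fun v hv hab => ?_
    have hle := hG.le v
    have := h (L v) hab.1 (by omega)
    rw [load, Nat.le_zero, Finset.card_eq_zero, Finset.filter_eq_empty_iff] at this
    exact this hv ⟨le_rfl, hle⟩
  | succ w ih =>
    intro F a b
    generalize hd : b - a = d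
    induction d using Nat.strong_induction_on generalizing a b with
    | _ d IH =>
    intro h
    by_cases hcov : ∀ p, a < p → p < b → ∃ v ∈ F, L v ≤ p ∧ p ≤ R v
    · rcases Nat.lt_or_ge a b with hab | hab
      · rw [Nat.mul_succ, add_comm]
        refine cutTree_of_cover hG hψ ih F a b (a + 1) (b - 1) k (by omega) (by omega) ?_ ?_ ?_ ?_
        · exact (Finset.card_le_univ _).trans (by simp)
        · exact fun p h1 h2 => hcov p (by omega) (by omega)
        · exact fun p h1 h2 => h p (by omega) (by omega)
        · intro p h1 h2 h3; omega
      · refine .empty fun v _ hv => ?_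
        have := hG.le v
        omega
    · push Not at hcov
      obtain ⟨p, h1, h2, hp⟩ := hcov
      refine .cut p h1 h2 (IH _ ?_ a p rfl fun q h3 h4 => h q h3 (by omega))
        (IH _ ?_ p b rfl fun q h3 h4 => h q (by omega) h4) (m' := k * (w + 1)) ?_
      · omega
      · omega
      · rw [Finset.card_eq_zero.2, zero_add]
        rw [Finset.filter_eq_empty_iff]
        intro u hu hu'
        have := hp u hu hu'.2.1
        omega

/-- A linear coloring of size `k` of an interval graph gives an elimination of cost `k²`. -/
theorem EvenRep.cutTree [Fintype V] {k : ℕ} (hG : EvenRep G L R) {ψ : V → Fin k}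
    (hψ : IsLinearColoring G ψ) (a b : ℕ) : CutTree L R Finset.univ a b (k ^ 2) := by
  rw [sq]
  refine cutTree_of_load_le hG hψ k Finset.univ a b fun p _ _ => ?_
  rw [load]
  refine (Finset.card_le_card_of_injOn ψ (fun _ _ => Finset.mem_univ _) ?_).trans
    (Finset.card_fin k).le
  intro u hu v hv huv
  simp only [Finset.coe_filter, Set.mem_ofPred_eq] at hu hv
  by_contra hne
  have hadj : G.Adj u v := (hG.adj u v).2 ⟨hne, by omega, by omega⟩
  -- An edge is a path on two vertices, so ψ is a proper coloring and a position carries at most k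
  -- intervals.
  obtain ⟨x, hx, h⟩ := hψ u v (.cons hadj .nil) (by simp [SimpleGraph.Walk.isPath_def, hne])
  simp only [SimpleGraph.Walk.support_cons, SimpleGraph.Walk.support_nil, List.mem_cons,
    List.not_mem_nil, or_false, Set.mem_ofPred_eq] at hx h
  rcases hx with rfl | rfl
  · exact hne (h v (.inr rfl) huv.symm).symm
  · exact hne (h u (.inl rfl) huv)

end

/-! ### Integer representations with few positions -/

/-- `L` and `R` are the endpoints of integer intervals in `0, …, N - 1` that represent `G`. -/
structure IntRep {V : Type*} (G : SimpleGraph V) (N : ℕ) (L R : V → ℕ) : Prop where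
  le : ∀ v, L v ≤ R v
  lt : ∀ v, R v < N
  adj : ∀ u v, G.Adj u v ↔ u ≠ v ∧ L u ≤ R v ∧ L v ≤ R u

/-- Replace an endpoint by the number of endpoints below it: adjacency depends only on comparisons
of left with right endpoints, and these are preserved. -/
theorem IsIntervalGraph.exists_intRep {V : Type*} [Fintype V] {G : SimpleGraph V}
    (hG : IsIntervalGraph G) : ∃ N L R, IntRep G N L R := by
  classical
  obtain ⟨f, -, hf⟩ := hG
  let E : Finset ℝ := Finset.univ.image (fun v => (f v).fst) ∪ Finset.univ.image fun v => (f v).snd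
  let rk : ℝ → ℕ := fun x => (E.filter fun e => e < x).card
  have hmono : ∀ {x y : ℝ}, x ≤ y → rk x ≤ rk y := by
    intro x y h
    refine Finset.card_le_card fun e he => ?_
    rw [Finset.mem_filter] at he ⊢
    exact ⟨he.1, he.2.trans_le h⟩
  have hstrict : ∀ {x y : ℝ}, x ∈ E → x < y → rk x < rk y := by
    intro x y hx h
    refine Finset.card_lt_card ((Finset.ssubset_iff_of_subset fun e he => ?_).2 ⟨x, ?_, ?_⟩)
    · rw [Finset.mem_filter] at he ⊢
      exact ⟨he.1, he.2.trans h⟩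
    · exact Finset.mem_filter.2 ⟨hx, h⟩
    · simp
  have hle : ∀ u v, (f u).fst ≤ (f v).snd ↔ rk (f u).fst ≤ rk (f v).snd := by
    intro u v
    refine ⟨hmono, fun h => ?_⟩
    by_contra hlt
    have := hstrict (x := (f v).snd) (by simp [E]) (not_le.1 hlt)
    omega
  refine ⟨E.card + 1, fun v => rk (f v).fst, fun v => rk (f v).snd,
    fun v => hmono (f v).fst_le_snd, fun v => Nat.lt_succ_of_le (Finset.card_filter_le _ _),
    fun u v => ?_⟩
  rw [hf, ← hle, ← hle]
  refine and_congr_right fun _ => ⟨?_, ?_⟩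
  · rintro ⟨x, hx, hy⟩
    rw [SetLike.mem_coe, NonemptyInterval.mem_def] at hx hy
    exact ⟨hx.1.trans hy.2, hy.1.trans hx.2⟩
  · rintro ⟨h1, h2⟩
    refine ⟨max (f u).fst (f v).fst, ?_, ?_⟩ <;> rw [SetLike.mem_coe, NonemptyInterval.mem_def]
    · exact ⟨le_max_left _ _, max_le (f u).fst_le_snd h2⟩
    · exact ⟨le_max_right _ _, max_le h1 (f v).fst_le_snd⟩

/-- Identifying p with p + 1 can create an adjacency only between an interval that ends at p and one
that begins at p + 1. -/
theorem IntRep.merge {V : Type*} {G : SimpleGraph V} {N p : ℕ} {L R : V → ℕ}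
    (h : IntRep G (N + 1) L R) (hp : p + 1 ≤ N)
    (hno : (∀ v, R v ≠ p) ∨ ∀ v, L v ≠ p + 1) : ∃ L R, IntRep G N L R := by
  let c : ℕ → ℕ := fun x => if x ≤ p then x else x - 1
  have hc : ∀ x y, x ≤ y → c x ≤ c y := by
    intro x y hxy; simp only [c]; split_ifs <;> omega
  refine ⟨fun v => c (L v), fun v => c (R v), fun v => hc _ _ (h.le v), fun v => ?_,
    fun u v => ?_⟩
  · have := h.lt v
    simp only [c]; split_ifs <;> omega
  · have key : ∀ u v, c (L u) ≤ c (R v) ↔ L u ≤ R v := by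
      intro u v
      refine ⟨fun hcc => ?_, hc _ _⟩
      rcases hno with hno | hno
      · have := hno v
        simp only [c] at hcc; split_ifs at hcc <;> omega
      · have := hno u
        simp only [c] at hcc; split_ifs at hcc <;> omega
    rw [h.adj, key, key]

/-- In a representation with as few positions as possible, any two consecutive positions are
separated by a right and a left endpoint. -/
theorem IsIntervalGraph.exists_tight_intRep {V : Type*} [Fintype V] {G : SimpleGraph V}
    (hG : IsIntervalGraph G) : ∃ N L R, IntRep G N L R ∧
      (∀ p, p < N → ∃ v, L v = p) ∧ (∀ p, p < N → ∃ v, R v = p) := by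
  classical
  have hex := hG.exists_intRep
  obtain ⟨L, R, h⟩ := Nat.find_spec hex
  have hmin : ∀ M, M < Nat.find hex → ¬∃ L R, IntRep G M L R := fun M hM => Nat.find_min hex hM
  generalize Nat.find hex = N at h hmin
  have hsep : ∀ p, p + 1 < N → (∃ v, R v = p) ∧ ∃ v, L v = p + 1 := by
    intro p hp
    obtain ⟨M, rfl⟩ : ∃ M, N = M + 1 := ⟨N - 1, by omega⟩
    by_contra hcon
    refine hmin M (by omega) (h.merge (p := p) (by omega) ?_)
    by_contra hno
    push Not at hno
    exact hcon hno
  have hlast : ∀ M, N = M + 1 → ∃ v : V, True := by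
    rintro M rfl
    by_contra hno
    push Not at hno
    -- Without vertices, zero positions would suffice.
    exact hmin 0 (by omega) ⟨L, R, fun v => (hno v).elim, fun v => (hno v).elim,
      fun v => (hno v).elim⟩
  refine ⟨N, L, R, h, fun p hp => ?_, fun p hp => ?_⟩
  -- No separation provides a left endpoint at the first position, but an interval that ends there
  -- also begins there. The last position is symmetric.
  · rcases Nat.eq_zero_or_pos p with rfl | hp0
    · rcases Nat.lt_or_ge 1 N with h1 | h1
      · obtain ⟨v, hv⟩ := (hsep 0 (by omega)).1
        exact ⟨v, by have := h.le v; omega⟩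
      · obtain ⟨v, -⟩ := hlast 0 (by omega)
        exact ⟨v, by have := h.le v; have := h.lt v; omega⟩
    · obtain ⟨v, hv⟩ := (hsep (p - 1) (by omega)).2
      exact ⟨v, by omega⟩
  · rcases Nat.lt_or_ge (p + 1) N with h1 | h1
    · exact (hsep p h1).1
    · rcases Nat.eq_zero_or_pos p with rfl | hp0
      · obtain ⟨v, -⟩ := hlast 0 (by omega)
        exact ⟨v, by have := h.lt v; omega⟩
      · obtain ⟨v, hv⟩ := (hsep (p - 1) (by omega)).2
        exact ⟨v, by have := h.le v; have := h.lt v; omega⟩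

/-- An interval graph on `n` vertices has a representation with even endpoints in `2, …, 2 * N`,
`N ≤ n`, in which the vertices at any position are the common neighbors (in the reflexive sense)
of two vertices. -/
theorem IsIntervalGraph.exists_evenRep {V : Type*} [Fintype V] {G : SimpleGraph V}
    (hG : IsIntervalGraph G) : ∃ N L R, N ≤ Fintype.card V ∧ EvenRep G L R ∧
      (∀ v, 2 ≤ L v ∧ R v ≤ 2 * N) ∧
      ∀ p, 2 ≤ p → p ≤ 2 * N → ∃ i j, ∀ x, (L x ≤ p ∧ p ≤ R x) ↔
        (i = x ∨ G.Adj i x) ∧ (j = x ∨ G.Adj j x) := by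
  obtain ⟨N, L, R, h, hL, hR⟩ := hG.exists_tight_intRep
  refine ⟨N, fun v => 2 * L v + 2, fun v => 2 * R v + 2, ?_, ⟨fun v => ?_, fun v => ?_,
    fun v => ?_, fun u v => ?_⟩, fun v => ?_, fun p hp1 hp2 => ?_⟩
  · choose g hg using fun p : Fin N => hL p p.2
    have hinj : Function.Injective g := fun p q hpq => Fin.ext (by rw [← hg p, ← hg q, hpq])
    simpa using Fintype.card_le_of_injective g hinj
  · have := h.le v; omega
  · exact ⟨L v + 1, by ring⟩
  · exact ⟨R v + 1, by ring⟩
  · rw [h.adj]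
    exact and_congr_right fun _ => ⟨fun h => by omega, fun h => by omega⟩
  · have := h.lt v; beta_reduce; omega
  · have hadj : ∀ i x, (i = x ∨ G.Adj i x) ↔ (L i ≤ R x ∧ L x ≤ R i) := by
      intro i x
      rw [h.adj]
      have := h.le i
      by_cases hix : i = x
      · subst hix; simp [this]
      · simp [hix]
    simp only [hadj]
    rcases Nat.even_or_odd' p with ⟨q, rfl | rfl⟩
    -- The even position 2 * q is the old position q - 1. An interval contains it iff it meets both
    -- one that begins there and one that ends there.
    · obtain ⟨i, hi⟩ := hL (q - 1) (by omega)
      obtain ⟨j, hj⟩ := hR (q - 1) (by omega)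
      have := h.le i
      have := h.le j
      exact ⟨i, j, fun x => by have := h.le x; omega⟩
    -- The odd position 2 * q + 1 is the gap between the old positions q - 1 and q. An interval
    -- contains it iff it meets both one that ends just before and one that begins just after.
    · obtain ⟨i, hi⟩ := hR (q - 1) (by omega)
      obtain ⟨j, hj⟩ := hL q (by omega)
      have := h.le i
      have := h.le j
      exact ⟨i, j, fun x => by have := h.le x; omega⟩

/-! ### Improving a centered coloring by a cut -/

/-- Every property that is passed on along `A` within `S` is constant on `S`. -/
def Linked (A : ℕ → ℕ → Prop) (S : Set ℕ) : Prop :=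
  ∀ P : ℕ → Prop, (∀ x ∈ S, ∀ y ∈ S, A x y → P x → P y) → ∀ x ∈ S, ∀ y ∈ S, P x → P y

theorem Linked.congr {A : ℕ → ℕ → Prop} {S : Set ℕ} (h : Linked A S) {f : ℕ → ℕ}
    (hf : ∀ x ∈ S, ∀ y ∈ S, A x y → f x = f y) {x y : ℕ} (hx : x ∈ S) (hy : y ∈ S) : f x = f y :=
  (h (fun z => f x = f z) (fun a ha b hb hab hxa => hxa.trans (hf a ha b hb hab)) x hx y hy rfl)

/-- `c` is a centered coloring of the vertices below `n` that satisfy `U`, with `v` a bound for the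
colors in the component of a vertex. -/
structure GoodCol (n : ℕ) (A : ℕ → ℕ → Prop) (U : ℕ → Prop) (v c : ℕ → ℕ) : Prop where
  const : ∀ x < n, ∀ y < n, U x → U y → A x y → v x = v y
  lt : ∀ x < n, U x → c x < v x
  center : ∀ S : Set ℕ, S.Nonempty → (∀ x ∈ S, x < n ∧ U x) → Linked A S →
    ∃ x ∈ S, ∀ y ∈ S, c y = c x → y = x

theorem GoodCol.congr {n : ℕ} {A : ℕ → ℕ → Prop} {U : ℕ → Prop} {v c v' c' : ℕ → ℕ}
    (h : GoodCol n A U v c) (hv : ∀ x < n, v' x = v x) (hc : ∀ x < n, c' x = c x) :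
    GoodCol n A U v' c' where
  const x hx y hy h1 h2 h3 := by rw [hv x hx, hv y hy]; exact h.const x hx y hy h1 h2 h3
  lt x hx h1 := by rw [hv x hx, hc x hx]; exact h.lt x hx h1
  center S h1 h2 h3 := by
    obtain ⟨x, hx, h4⟩ := h.center S h1 h2 h3
    refine ⟨x, hx, fun y hy hxy => h4 y hy ?_⟩
    rwa [hc x (h2 x hx).1, hc y (h2 y hy).1] at hxy

/-- The vertices outside the sets `X i` and `X j`. -/
def Free (X : ℕ → ℕ → Prop) (i j x : ℕ) : Prop := ¬X i x ∧ ¬X j x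

/-- The vertices of the cut `X l` outside the sets `X i` and `X j`. -/
def CutSet (X : ℕ → ℕ → Prop) (i j l x : ℕ) : Prop := X l x ∧ Free X i j x

/-- `M` lies above `g`, is constant on components, and is not larger than the maximum of `g` on a
component. -/
structure IsSpread (n : ℕ) (A : ℕ → ℕ → Prop) (U : ℕ → Prop) (g M : ℕ → ℕ) : Prop where
  le : ∀ x < n, g x ≤ M x
  const : ∀ x < n, ∀ y < n, U x → U y → A x y → M x = M y
  bound : ∀ (Z : ℕ → Prop), (∀ x < n, ∀ y < n, U x → U y → A x y → Z x → Z y) → ∀ m,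
    (∀ x < n, Z x → g x ≤ m) → ∀ x < n, Z x → M x ≤ m

section

open Classical in
/-- The bound for the component of `x` after cutting out `X l`. -/
noncomputable def restVal (X : ℕ → ℕ → Prop) (v : ℕ → ℕ → ℕ → ℕ) (i j l x : ℕ) : ℕ :=
  if X l x then 0 else min (v i l x) (v l j x)

/-- The color of `x` after cutting out `X l`. -/
def restCol (v c : ℕ → ℕ → ℕ → ℕ) (i j l x : ℕ) : ℕ :=
  if v l j x < v i l x then c l j x else c i l x

open Classical in
/-- The improved bound. -/
noncomputable def newVal (n : ℕ) (X : ℕ → ℕ → Prop) (v : ℕ → ℕ → ℕ → ℕ) (M : ℕ → ℕ)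
    (i j l x : ℕ) : ℕ :=
  if Free X i j x ∧ Nat.count (CutSet X i j l) n + M x < v i j x
  then Nat.count (CutSet X i j l) n + M x else v i j x

open Classical in
/-- The improved coloring. -/
noncomputable def newCol (n : ℕ) (X : ℕ → ℕ → Prop) (v c : ℕ → ℕ → ℕ → ℕ) (M : ℕ → ℕ)
    (i j l x : ℕ) : ℕ :=
  if Free X i j x ∧ Nat.count (CutSet X i j l) n + M x < v i j x
  then if X l x then M x + Nat.count (CutSet X i j l) x else restCol v c i j l x
  else c i j x

variable {n : ℕ} {A X : ℕ → ℕ → Prop} {v c : ℕ → ℕ → ℕ → ℕ} {M : ℕ → ℕ} {i j l : ℕ}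

theorem restCol_lt (hil : GoodCol n A (Free X i l) (v i l) (c i l))
    (hlj : GoodCol n A (Free X l j) (v l j) (c l j)) {x : ℕ} (hx : x < n) (hU : Free X i j x)
    (hxl : ¬X l x) : restCol v c i j l x < restVal X v i j l x := by
  have h1 := hil.lt x hx ⟨hU.1, hxl⟩
  have h2 := hlj.lt x hx ⟨hxl, hU.2⟩
  rw [restCol, restVal, if_neg hxl]
  split_ifs with h
  · exact lt_min (h2.trans h) h2
  · exact lt_min h1 (h1.trans_le (not_lt.1 h))

/-- Whether a vertex is recolored depends on values that are constant on components. In a recolored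
connected set any vertex of the cut is a center: the cut has distinct colors from M upwards, the
rest uses colors below M. A connected set that avoids the cut is linked in the graphs of both rows
(i, l) and (l, j), so it takes one of the two colorings as a whole. -/
theorem goodCol_new (hij : GoodCol n A (Free X i j) (v i j) (c i j))
    (hil : GoodCol n A (Free X i l) (v i l) (c i l))
    (hlj : GoodCol n A (Free X l j) (v l j) (c l j))
    (hM : IsSpread n A (Free X i j) (restVal X v i j l) M) :
    GoodCol n A (Free X i j) (newVal n X v M i j l) (newCol n X v c M i j l) := by
  classical
  have hcut : ∀ x < n, Free X i j x → X l x →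
      Nat.count (CutSet X i j l) x < Nat.count (CutSet X i j l) n := fun x hx hU hxl =>
    Nat.count_strict_mono ⟨hxl, hU⟩ hx
  have hiff : ∀ x < n, ∀ y < n, Free X i j x → Free X i j y → A x y →
      v i j x = v i j y ∧ M x = M y := fun x hx y hy h1 h2 h3 =>
    ⟨hij.const x hx y hy h1 h2 h3, hM.const x hx y hy h1 h2 h3⟩
  constructor
  · intro x hx y hy h1 h2 h3
    obtain ⟨h4, h5⟩ := hiff x hx y hy h1 h2 h3
    simp only [newVal, h1, h2, true_and, h4, h5]
  · intro x hx h1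
    simp only [newVal, newCol, h1, true_and]
    split_ifs with h2 h3
    · have := hcut x hx h1 h3
      omega
    · have := restCol_lt hil hlj hx h1 h3
      have := hM.le x hx
      omega
    · exact hij.lt x hx h1
  · intro S hne hS hlink
    obtain ⟨x₀, hx₀⟩ := hne
    have hconst : ∀ x ∈ S, v i j x = v i j x₀ ∧ M x = M x₀ := fun x hx =>
      ⟨hlink.congr (f := v i j) (fun a ha b hb hab =>
        (hiff a (hS a ha).1 b (hS b hb).1 (hS a ha).2 (hS b hb).2 hab).1) hx hx₀,
      hlink.congr (f := M) (fun a ha b hb hab =>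
        (hiff a (hS a ha).1 b (hS b hb).1 (hS a ha).2 (hS b hb).2 hab).2) hx hx₀⟩
    by_cases himp : Nat.count (CutSet X i j l) n + M x₀ < v i j x₀
    swap
    · obtain ⟨x, hx, h⟩ := hij.center S ⟨x₀, hx₀⟩ hS hlink
      have hold : ∀ y ∈ S, newCol n X v c M i j l y = c i j y := fun y hy => by
        rw [newCol, if_neg]
        rw [(hconst y hy).1, (hconst y hy).2]; tauto
      exact ⟨x, hx, fun y hy hyx => h y hy (by rwa [hold x hx, hold y hy] at hyx)⟩
    have hnew : ∀ y ∈ S, newCol n X v c M i j l y =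
        if X l y then M x₀ + Nat.count (CutSet X i j l) y else restCol v c i j l y := by
      intro y hy
      rw [newCol, if_pos, (hconst y hy).2]
      rw [(hconst y hy).1, (hconst y hy).2]; exact ⟨(hS y hy).2, himp⟩
    by_cases hl : ∃ x ∈ S, X l x
    · obtain ⟨x, hx, hxl⟩ := hl
      refine ⟨x, hx, fun y hy hyx => ?_⟩
      rw [hnew y hy, hnew x hx, if_pos hxl] at hyx
      split_ifs at hyx with hyl
      · exact Nat.count_injective (p := CutSet X i j l) ⟨hyl, (hS y hy).2⟩ ⟨hxl, (hS x hx).2⟩ (by omega)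
      · have h1 := restCol_lt hil hlj (hS y hy).1 (hS y hy).2 hyl
        have h2 := hM.le y (hS y hy).1
        have := (hconst y hy).2
        omega
    · push Not at hl
      have hil' : ∀ y ∈ S, y < n ∧ Free X i l y := fun y hy =>
        ⟨(hS y hy).1, (hS y hy).2.1, hl y hy⟩
      have hlj' : ∀ y ∈ S, y < n ∧ Free X l j y := fun y hy =>
        ⟨(hS y hy).1, hl y hy, (hS y hy).2.2⟩
      have h1 : ∀ y ∈ S, v i l y = v i l x₀ := fun y hy => hlink.congr (f := v i l)
        (fun a ha b hb hab => hil.const a (hil' a ha).1 b (hil' b hb).1 (hil' a ha).2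
          (hil' b hb).2 hab) hy hx₀
      have h2 : ∀ y ∈ S, v l j y = v l j x₀ := fun y hy => hlink.congr (f := v l j)
        (fun a ha b hb hab => hlj.const a (hlj' a ha).1 b (hlj' b hb).1 (hlj' a ha).2
          (hlj' b hb).2 hab) hy hx₀
      by_cases hlt : v l j x₀ < v i l x₀
      · obtain ⟨x, hx, h⟩ := hlj.center S ⟨x₀, hx₀⟩ hlj' hlink
        have hold : ∀ y ∈ S, newCol n X v c M i j l y = c l j y := fun y hy => by
          rw [hnew y hy, if_neg (hl y hy), restCol, h1 y hy, h2 y hy, if_pos hlt]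
        exact ⟨x, hx, fun y hy hyx => h y hy (by rwa [hold x hx, hold y hy] at hyx)⟩
      · obtain ⟨x, hx, h⟩ := hil.center S ⟨x₀, hx₀⟩ hil' hlink
        have hold : ∀ y ∈ S, newCol n X v c M i j l y = c i l y := fun y hy => by
          rw [hnew y hy, if_neg (hl y hy), restCol, h1 y hy, h2 y hy, if_neg hlt]
        exact ⟨x, hx, fun y hy hyx => h y hy (by rwa [hold x hx, hold y hy] at hyx)⟩

theorem newVal_le (x : ℕ) : newVal n X v M i j l x ≤ v i j x := by
  rw [newVal]; split_ifs with h
  · exact h.2.le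
  · exact le_rfl

-- Which of the two rows satisfies the bound m may vary from vertex to vertex; the minimum in
-- `restVal` absorbs the choice.
open Classical in
theorem newVal_le_of_bound (hM : IsSpread n A (Free X i j) (restVal X v i j l) M)
    {Z : ℕ → Prop} (hZ : ∀ x < n, ∀ y < n, Free X i j x → Free X i j y → A x y → Z x → Z y)
    {m : ℕ} (hm : ∀ x < n, Z x → ¬X l x → v i l x ≤ m ∨ v l j x ≤ m) {x : ℕ} (hx : x < n)
    (hxZ : Z x) (hU : Free X i j x) :
    newVal n X v M i j l x ≤ Nat.count (CutSet X i j l) n + m := by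
  have : M x ≤ m := by
    refine hM.bound Z hZ m (fun y hy hyZ => ?_) x hx hxZ
    rw [restVal]; split_ifs with h
    · exact Nat.zero_le _
    · exact min_le_iff.2 (hm y hy hyZ h)
  rw [newVal]; split_ifs with h
  · omega
  · have : ¬(Nat.count (CutSet X i j l) n + M x < v i j x) := fun h' => h ⟨hU, h'⟩
    omega

/-- `y` can be reached from `x` in at most `t` steps along `A` within `U`. -/
def Near (n : ℕ) (A : ℕ → ℕ → Prop) (U : ℕ → Prop) : ℕ → ℕ → ℕ → Prop
  | 0, x, y => x = y
  | t + 1, x, y => Near n A U t x y ∨ ∃ z < n, A x z ∧ U x ∧ U z ∧ Near n A U t z y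

theorem Near.mono {U : ℕ → Prop} {t t' x y : ℕ} (h : Near n A U t x y) (ht : t ≤ t') :
    Near n A U t' x y := by
  induction ht with
  | refl => exact h
  | step _ ih => exact .inl ih

/-- The graph on the vertices below `n` given by `A` within `U`. -/
def stepGraph (n : ℕ) (A : ℕ → ℕ → Prop) (U : ℕ → Prop) : SimpleGraph (Fin n) where
  Adj x y := x ≠ y ∧ (A x y ∧ A y x) ∧ U x ∧ U y
  symm := ⟨fun _ _ h => ⟨h.1.symm, h.2.1.symm, h.2.2.symm⟩⟩
  loopless := ⟨fun _ h => h.1 rfl⟩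

theorem near_of_walk {U : ℕ → Prop} {x y : Fin n} (p : (stepGraph n A U).Walk x y) :
    Near n A U p.length x y := by
  induction p with
  | nil => exact rfl
  | @cons x z y h p ih => exact .inr ⟨z, z.2, h.2.1.1, h.2.2.1, h.2.2.2, ih⟩

/-- On the component of y the values of g are at most M y, since n steps reach all of it. Applying
the upper bound to this closed set gives M x ≤ M y for a neighbor x, and symmetry gives equality. -/
theorem IsSpread.of_near {U : ℕ → Prop} {g M : ℕ → ℕ} (hA : ∀ x y, A x y → A y x)
    (hle : ∀ x < n, ∀ y, Near n A U n x y → g y ≤ M x)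
    (hbound : ∀ (Z : ℕ → Prop), (∀ x < n, ∀ y < n, U x → U y → A x y → Z x → Z y) → ∀ m,
      (∀ x < n, Z x → g x ≤ m) → ∀ x < n, Z x → M x ≤ m) : IsSpread n A U g M := by
  refine ⟨fun x hx => hle x hx x (Near.mono (t := 0) rfl (Nat.zero_le n)), ?_, hbound⟩
  suffices h : ∀ x < n, ∀ y < n, U x → U y → A x y → M x ≤ M y from
    fun x hx y hy h1 h2 h3 => le_antisymm (h x hx y hy h1 h2 h3) (h y hy x hx h2 h1 (hA _ _ h3))
  intro x hx y hy h1 h2 h3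
  refine hbound (fun z => ∃ hz : z < n, (stepGraph n A U).Reachable ⟨y, hy⟩ ⟨z, hz⟩) ?_ (M y) ?_ x
    hx ⟨hx, ?_⟩
  · rintro a ha b hb h4 h5 h6 ⟨_, h7⟩
    refine ⟨hb, ?_⟩
    by_cases hab : a = b
    · subst hab; exact h7
    · refine h7.trans (SimpleGraph.Adj.reachable (G := stepGraph n A U) ⟨?_, ⟨h6, hA _ _ h6⟩, h4, h5⟩)
      simpa using hab
  · rintro z - ⟨hz, ⟨p⟩⟩
    classical
    have hlen := p.toPath.2.length_lt
    rw [Fintype.card_fin] at hlen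
    exact hle y hy z ((near_of_walk (x := ⟨y, hy⟩) (y := ⟨z, hz⟩) p.toPath.1).mono hlen.le)
  · by_cases hab : y = x
    · subst hab; exact .refl _
    · refine SimpleGraph.Adj.reachable (G := stepGraph n A U) ⟨?_, ⟨hA _ _ h3, h3⟩, h2, h1⟩
      simpa using hab

end

/-! ### A single relaxation on the machine -/

namespace RAM

open RAM.Expr in
/-- Whether the vertex in register `x` is in the set of the family given by register `q`. -/
def famExpr (q x : ℕ) : Expr := get 5 (add (get 3 (reg q)) (reg x))

namespace Stm

open RAM.Expr

/-- Ranks and number of the vertices in the cut. -/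
def cutRank : Stm :=
  seq (set 12 (lit 0)) (iter 8 0 (ite (sub (famExpr 7 8) (add (famExpr 5 8) (famExpr 6 8)))
    (seq (put 8 (reg 8) (reg 12)) (set 12 (add (reg 12) (lit 1)))) skip))

/-- Bounds and colors after cutting. -/
def rest : Stm :=
  iter 8 0 (ite (famExpr 7 8) (put 9 (reg 8) (lit 0))
    (ite (sub (get 6 (add (reg 14) (reg 8))) (get 6 (add (reg 15) (reg 8))))
      (seq (put 9 (reg 8) (get 6 (add (reg 15) (reg 8))))
        (put 10 (reg 8) (get 7 (add (reg 15) (reg 8)))))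
      (seq (put 9 (reg 8) (get 6 (add (reg 14) (reg 8))))
        (put 10 (reg 8) (get 7 (add (reg 14) (reg 8)))))))

/-- Pass the entry of one vertex to another one. -/
def spreadStep : Stm :=
  ite (sub (get 0 (add (get 3 (reg 8)) (reg 9)))
      (add (add (famExpr 5 8) (famExpr 6 8)) (add (famExpr 5 9) (famExpr 6 9))))
    (ite (sub (get 9 (reg 9)) (get 9 (reg 8))) (put 9 (reg 8) (get 9 (reg 9))) skip) skip

/-- Maxima over components. -/
def spread : Stm := iter 11 0 (iter 8 0 (iter 9 0 spreadStep))

/-- Update of the tables. -/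
def update : Stm :=
  iter 8 0 (ite (sub (lit 1) (add (famExpr 5 8) (famExpr 6 8)))
    (ite (sub (get 6 (add (reg 13) (reg 8))) (add (reg 12) (get 9 (reg 8))))
      (seq (put 6 (add (reg 13) (reg 8)) (add (reg 12) (get 9 (reg 8))))
        (ite (famExpr 7 8)
          (put 7 (add (reg 13) (reg 8)) (add (get 9 (reg 8)) (get 8 (reg 8))))
          (put 7 (add (reg 13) (reg 8)) (get 10 (reg 8))))) skip) skip)

/-- Compute the addresses of the rows of the tables. -/
def bases : Stm :=
  seq (set 13 (add (get 4 (reg 5)) (get 3 (reg 6))))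
    (seq (set 14 (add (get 4 (reg 5)) (get 3 (reg 7))))
      (set 15 (add (get 4 (reg 7)) (get 3 (reg 6)))))

/-- Improve one row of the tables by one cut. -/
def relax : Stm := seq bases (seq cutRank (seq rest (seq spread update)))

end Stm

/-- The constant parts of the memory: sizes, addresses, adjacency, and the family of sets. -/
structure Consts (n Q : ℕ) (A X : ℕ → ℕ → Prop) [∀ x, DecidablePred (A x)]
    [∀ x, DecidablePred (X x)] (s : State) : Prop where
  reg0 : s.reg 0 = n
  reg4 : s.reg 4 = Q
  row : ∀ q < Q, s.arr 3 q = q * n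
  block : ∀ q < Q, s.arr 4 q = q * (Q * n)
  adj : ∀ x < n, ∀ y < n, s.arr 0 (x * n + y) = if A x y then 1 else 0
  fam : ∀ q < Q, ∀ x < n, s.arr 5 (q * n + x) = if X q x then 1 else 0

section

variable {n Q : ℕ} {A X : ℕ → ℕ → Prop} [∀ x, DecidablePred (A x)] [∀ x, DecidablePred (X x)]
  {s : State} {i j l : ℕ}

theorem Consts.congr {s' : State} (h : Consts n Q A X s) (h0 : s'.reg 0 = s.reg 0)
    (h4 : s'.reg 4 = s.reg 4) (ha : ∀ a ∈ [0, 3, 4, 5], s'.arr a = s.arr a) :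
    Consts n Q A X s' := by
  simp only [List.mem_cons, List.not_mem_nil, or_false, forall_eq_or_imp, forall_eq] at ha
  obtain ⟨a0, a3, a4, a5⟩ := ha
  exact ⟨h0 ▸ h.reg0, h4 ▸ h.reg4, a3 ▸ h.row, a4 ▸ h.block, a0 ▸ h.adj, a5 ▸ h.fam⟩

theorem Consts.agree (h : Consts n Q A X s) {rs as : List ℕ} {s' : State}
    (hs : Agree rs as s s') (h0 : 0 ∉ rs := by decide) (h4 : 4 ∉ rs := by decide)
    (ha : ∀ a ∈ [0, 3, 4, 5], a ∉ as := by decide) : Consts n Q A X s' :=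
  h.congr (hs.reg 0 h0) (hs.reg 4 h4) fun a h => hs.arr a (ha a h)

theorem Consts.setReg (h : Consts n Q A X s) {x c : ℕ} (h0 : x ≠ 0) (h4 : x ≠ 4) :
    Consts n Q A X (s.setReg x c) :=
  h.congr (Function.update_of_ne h0.symm _ _) (Function.update_of_ne h4.symm _ _) fun _ _ => rfl

theorem Consts.eval_famExpr (h : Consts n Q A X s) {q x : ℕ} (hq : s.reg q < Q)
    (hx : s.reg x < n) : (famExpr q x).eval s = if X (s.reg q) (s.reg x) then 1 else 0 := by
  simp only [famExpr, Expr.eval]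
  rw [h.row _ hq, h.fam _ hq _ hx]

/-- The indices of the current row and cut. -/
structure Indices (Q i j l : ℕ) (s : State) : Prop where
  reg5 : s.reg 5 = i
  reg6 : s.reg 6 = j
  reg7 : s.reg 7 = l
  lt5 : i < Q
  lt6 : j < Q
  lt7 : l < Q

theorem Indices.agree (h : Indices Q i j l s) {rs as : List ℕ} {s' : State}
    (hs : Agree rs as s s') (h5 : 5 ∉ rs := by decide) (h6 : 6 ∉ rs := by decide)
    (h7 : 7 ∉ rs := by decide) : Indices Q i j l s' :=
  ⟨(hs.reg 5 h5).trans h.reg5, (hs.reg 6 h6).trans h.reg6, (hs.reg 7 h7).trans h.reg7,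
    h.lt5, h.lt6, h.lt7⟩

/-- The values of the membership tests for the vertex in register `x`. -/
theorem Consts.eval_fam (h : Consts n Q A X s) (hi : Indices Q i j l s) {x m : ℕ}
    (hx : s.reg x = m) (hm : m < n) :
    (famExpr 5 x).eval s = (if X i m then 1 else 0) ∧
    (famExpr 6 x).eval s = (if X j m then 1 else 0) ∧
    (famExpr 7 x).eval s = (if X l m then 1 else 0) := by
  refine ⟨?_, ?_, ?_⟩
  · rw [h.eval_famExpr (by rw [hi.reg5]; exact hi.lt5) (by omega), hi.reg5, hx]
  · rw [h.eval_famExpr (by rw [hi.reg6]; exact hi.lt6) (by omega), hi.reg6, hx]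
  · rw [h.eval_famExpr (by rw [hi.reg7]; exact hi.lt7) (by omega), hi.reg7, hx]

open Classical in
theorem run_cutRank (h : Consts n Q A X s) (hi : Indices Q i j l s) :
    (Stm.cutRank.run s).reg 12 = Nat.count (CutSet X i j l) n ∧
      ∀ y < n, CutSet X i j l y →
        (Stm.cutRank.run s).arr 8 y = Nat.count (CutSet X i j l) y := by
  have key := Stm.run_iter (x := 8) (b := 0)
    (p := .ite (.sub (famExpr 7 8) (.add (famExpr 5 8) (famExpr 6 8)))
      (.seq (.put 8 (.reg 8) (.reg 12)) (.set 12 (.add (.reg 12) (.lit 1)))) .skip)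
    (s := s.setReg 12 0)
    (fun m s' => s'.reg 12 = Nat.count (CutSet X i j l) m ∧
      ∀ y < m, CutSet X i j l y → s'.arr 8 y = Nat.count (CutSet X i j l) y)
    (by decide) ⟨by simp [State.setReg], by simp⟩
    (by
      intro m hm s' hx hs ⟨h3, h4⟩
      have hm : m < n := by rw [← h.reg0]; exact hm
      have h12 : Agree [12] [] s (s.setReg 12 0) := Stm.run_agree (.set 12 (.lit 0)) s
      obtain ⟨e5, e6, e7⟩ := ((h.agree h12).agree hs).eval_fam ((hi.agree h12).agree hs) hx hm
      -- For values 0 and 1, a truncated difference is nonzero iff the minuend is 1 and everything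
      -- subtracted is 0; this is how conjunctions and negations are computed.
      have hcond : ((if X l m then 1 else 0) - ((if X i m then 1 else 0) + if X j m then 1 else 0)
          ≠ 0) ↔ CutSet X i j l m := by
        by_cases c1 : X l m <;> by_cases c2 : X i m <;> by_cases c3 : X j m <;>
          simp [CutSet, Free, c1, c2, c3]
      simp only [Stm.run, Expr.eval, e5, e6, e7, hcond]
      by_cases hc : CutSet X i j l m
      · simp only [if_pos hc]
        refine ⟨by simp [State.setReg, State.setArr, Nat.count_succ, hc, h3], fun y hy hyc => ?_⟩
        rcases Nat.lt_succ_iff_lt_or_eq.1 hy with hy | rfl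
        · simp [State.setReg, State.setArr, hx, Function.update_of_ne hy.ne, h4 y hy hyc]
        · simp [State.setReg, State.setArr, hx, h3]
      · simp only [if_neg hc]
        refine ⟨by simp [State.setReg, Nat.count_succ, hc, h3], fun y hy hyc => ?_⟩
        rcases Nat.lt_succ_iff_lt_or_eq.1 hy with hy | rfl
        · simpa [State.setReg] using h4 y hy hyc
        · exact absurd hyc hc)
  rw [show (s.setReg 12 0).reg 0 = n from h.reg0] at key
  exact key

/-- The table in array `a`: the entry of `x` in the row `(i, j)`. -/
def State.table (s : State) (n Q a i j x : ℕ) : ℕ := s.arr a (i * (Q * n) + j * n + x)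

theorem run_rest (h : Consts n Q A X s) (hi : Indices Q i j l s)
    (h14 : s.reg 14 = i * (Q * n) + l * n) (h15 : s.reg 15 = l * (Q * n) + j * n) :
    ∀ y < n, (Stm.rest.run s).arr 9 y = restVal X (s.table n Q 6) i j l y ∧
      (¬X l y → (Stm.rest.run s).arr 10 y = restCol (s.table n Q 6) (s.table n Q 7) i j l y) := by
  have key := Stm.run_iter (x := 8) (b := 0)
    (p := .ite (famExpr 7 8) (.put 9 (.reg 8) (.lit 0))
      (.ite (.sub (.get 6 (.add (.reg 14) (.reg 8))) (.get 6 (.add (.reg 15) (.reg 8))))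
        (.seq (.put 9 (.reg 8) (.get 6 (.add (.reg 15) (.reg 8))))
          (.put 10 (.reg 8) (.get 7 (.add (.reg 15) (.reg 8)))))
        (.seq (.put 9 (.reg 8) (.get 6 (.add (.reg 14) (.reg 8))))
          (.put 10 (.reg 8) (.get 7 (.add (.reg 14) (.reg 8)))))))
    (s := s)
    (fun m s' => ∀ y < m, s'.arr 9 y = restVal X (s.table n Q 6) i j l y ∧
      (¬X l y → s'.arr 10 y = restCol (s.table n Q 6) (s.table n Q 7) i j l y))
    (by decide) (by simp)
    (by
      intro m hm s' hx hs h4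
      rw [h.reg0] at hm
      obtain ⟨-, -, e7⟩ := (h.agree hs).eval_fam (hi.agree hs) hx hm
      have e14 := hs.reg 14 (by decide)
      have e15 := hs.reg 15 (by decide)
      have a6 := hs.arr 6 (by decide)
      have a7 := hs.arr 7 (by decide)
      have hsub : ∀ a b : ℕ, (a - b ≠ 0) ↔ b < a := fun a b => by omega
      simp only [Stm.run, Expr.eval, e7, a6, e14, e15, hx, h14, h15, hsub]
      intro y hy
      by_cases hc : X l m
      · simp only [if_pos hc]
        rcases Nat.lt_succ_iff_lt_or_eq.1 hy with hy | rfl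
        · simpa [State.setReg, State.setArr, hx, Function.update_of_ne hy.ne] using h4 y hy
        · simp [State.setReg, State.setArr, restVal, hc]
      · simp only [if_neg hc, ne_eq, not_true_eq_false, if_false]
        split_ifs with hlt
        · rcases Nat.lt_succ_iff_lt_or_eq.1 hy with hy | rfl
          · simpa [State.setReg, State.setArr, hx, Function.update_of_ne hy.ne] using h4 y hy
          · simp [State.setReg, State.setArr, restVal, restCol, hc, State.table, hlt, hlt.le, a7,
              e15, h15, hx]
        · rcases Nat.lt_succ_iff_lt_or_eq.1 hy with hy | rfl
          · simpa [State.setReg, State.setArr, hx, Function.update_of_ne hy.ne] using h4 y hy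
          · simp [State.setReg, State.setArr, restVal, restCol, hc, State.table, hlt, not_lt.1 hlt,
              a7, e14, h14, hx])
  rw [h.reg0] at key
  exact key

open Classical in
theorem run_spreadStep (h : Consts n Q A X s) (hi : Indices Q i j l s) {x y : ℕ}
    (h8 : s.reg 8 = x) (h9 : s.reg 9 = y) (hx : x < n) (hy : y < n) (hnQ : n ≤ Q) :
    (∀ z, (Stm.spreadStep.run s).arr 9 z = s.arr 9 z ∨ z = x ∧ A x y ∧ Free X i j x ∧ Free X i j y ∧
      (Stm.spreadStep.run s).arr 9 z = s.arr 9 y) ∧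
    (∀ z, s.arr 9 z ≤ (Stm.spreadStep.run s).arr 9 z) ∧
    (A x y → Free X i j x → Free X i j y → s.arr 9 y ≤ (Stm.spreadStep.run s).arr 9 x) := by
  obtain ⟨e5, e6, -⟩ := h.eval_fam hi h8 hx
  obtain ⟨f5, f6, -⟩ := h.eval_fam hi h9 hy
  have hcond : (((if A x y then 1 else 0) - ((if X i x then 1 else 0) + (if X j x then 1 else 0) +
      ((if X i y then 1 else 0) + if X j y then 1 else 0))) ≠ 0) ↔
      A x y ∧ Free X i j x ∧ Free X i j y := by
    by_cases c : A x y <;> by_cases c1 : X i x <;> by_cases c2 : X j x <;>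
      by_cases c3 : X i y <;> by_cases c4 : X j y <;> simp [Free, c, c1, c2, c3, c4]
  have hsub : ∀ a b : ℕ, (a - b ≠ 0) ↔ b < a := fun a b => by omega
  have hE : (Expr.sub (.get 0 (.add (.get 3 (.reg 8)) (.reg 9)))
      (.add (.add (famExpr 5 8) (famExpr 6 8)) (.add (famExpr 5 9) (famExpr 6 9)))).eval s =
      (if A x y then 1 else 0) - ((if X i x then 1 else 0) + (if X j x then 1 else 0) +
        ((if X i y then 1 else 0) + if X j y then 1 else 0)) := by
    simp only [Expr.eval, e5, e6, f5, f6, h8, h9, h.row x (by omega), h.adj x hx y hy]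
  have hrun : Stm.spreadStep.run s = if A x y ∧ Free X i j x ∧ Free X i j y then
      (if s.arr 9 x < s.arr 9 y then s.setArr 9 x (s.arr 9 y) else s) else s := by
    rw [Stm.spreadStep, Stm.run, hE]
    simp only [hcond, hsub, Stm.run, Expr.eval, h8, h9]
  rw [hrun]
  by_cases hc : A x y ∧ Free X i j x ∧ Free X i j y
  · rw [if_pos hc]
    split_ifs with hlt
    · refine ⟨fun z => ?_, fun z => ?_, fun _ _ _ => ?_⟩
      · by_cases hz : z = x
        · subst hz
          exact .inr ⟨rfl, hc.1, hc.2.1, hc.2.2, by simp [State.setArr]⟩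
        · exact .inl (by simp [State.setArr, hz])
      · by_cases hz : z = x
        · subst hz; simpa [State.setArr] using hlt.le
        · simp [State.setArr, hz]
      · simp [State.setArr]
    · exact ⟨fun z => .inl rfl, fun z => le_rfl, fun _ _ _ => not_lt.1 hlt⟩
  · rw [if_neg hc]
    exact ⟨fun z => .inl rfl, fun z => le_rfl, fun h1 h2 h3 => absurd ⟨h1, h2, h3⟩ hc⟩

/-- Values never decrease and travel only along edges of the free graph, so they respect every upper
bound on a closed set (`B`). Pass number t accounts for walks of at most t steps, and updating in
place does no harm because it can only bring larger values earlier. -/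
theorem run_spread (hA : ∀ x y, A x y → A y x) (h : Consts n Q A X s) (hi : Indices Q i j l s)
    (hnQ : n ≤ Q) : IsSpread n A (Free X i j) (s.arr 9) ((Stm.spread.run s).arr 9) := by
  let U := Free X i j
  let B : State → Prop := fun s' => (∀ z, s.arr 9 z ≤ s'.arr 9 z) ∧
    ∀ (Z : ℕ → Prop), (∀ x < n, ∀ y < n, U x → U y → A x y → Z x → Z y) → ∀ m,
      (∀ x < n, Z x → s.arr 9 x ≤ m) → ∀ x < n, Z x → s'.arr 9 x ≤ m
  have hB : ∀ s' x y, Consts n Q A X s' → Indices Q i j l s' → s'.reg 8 = x → s'.reg 9 = y →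
      x < n → y < n → B s' → B (Stm.spreadStep.run s') := by
    intro s' x y hs' hi' h8 h9 hx hy ⟨hB1, hB2⟩
    obtain ⟨h1, h2, -⟩ := run_spreadStep hs' hi' h8 h9 hx hy hnQ
    refine ⟨fun z => (hB1 z).trans (h2 z), fun Z hZ m hm z hz hzZ => ?_⟩
    rcases h1 z with h1 | ⟨rfl, h3, h4, h5, h1⟩
    · rw [h1]; exact hB2 Z hZ m hm z hz hzZ
    · rw [h1]; exact hB2 Z hZ m hm y hy (hZ z hx y hy h4 h5 h3 hzZ)
  have key := Stm.run_iter (x := 11) (b := 0) (p := .iter 8 0 (.iter 9 0 Stm.spreadStep)) (s := s)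
    (fun t s' => B s' ∧ ∀ x < n, ∀ y, Near n A U t x y → s.arr 9 y ≤ s'.arr 9 x)
    (by decide)
    ⟨⟨fun _ => le_rfl, fun _ _ _ h => h⟩, by rintro x _ _ rfl; exact le_rfl⟩
    (by
      rintro t - s₁ - hs₁ ⟨hB₁, ht⟩
      have k₁ := h.agree hs₁
      have i₁ := hi.agree hs₁
      have key₁ := Stm.run_iter (x := 8) (b := 0) (p := .iter 9 0 Stm.spreadStep) (s := s₁)
        (fun m s' => B s' ∧ (∀ z, s₁.arr 9 z ≤ s'.arr 9 z) ∧
          ∀ x < m, ∀ y, Near n A U (t + 1) x y → s.arr 9 y ≤ s'.arr 9 x)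
        (by decide) ⟨hB₁, fun _ => le_rfl, by simp⟩
        (by
          rintro x hx s₂ hx₂ hs₂ ⟨hB₂, hle₂, hm⟩
          rw [k₁.reg0] at hx
          have k₂ := k₁.agree hs₂
          have i₂ := i₁.agree hs₂
          have key₂ := Stm.run_iter (x := 9) (b := 0) (p := Stm.spreadStep) (s := s₂)
            (fun m s' => B s' ∧ (∀ z, s₂.arr 9 z ≤ s'.arr 9 z) ∧
              ∀ z < m, A x z → U x → U z → s₂.arr 9 z ≤ s'.arr 9 x)
            (by decide) ⟨hB₂, fun _ => le_rfl, by simp⟩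
            (by
              rintro y hy s₃ hy₃ hs₃ ⟨hB₃, hle₃, hm₃⟩
              rw [k₂.reg0] at hy
              have k₃ := k₂.agree hs₃
              have i₃ := i₂.agree hs₃
              have hx₃ : s₃.reg 8 = x := (hs₃.reg 8 (by decide)).trans hx₂
              obtain ⟨-, h2, h3⟩ := run_spreadStep k₃ i₃ hx₃ hy₃ hx hy hnQ
              refine ⟨hB s₃ x y k₃ i₃ hx₃ hy₃ hx hy hB₃, fun z => (hle₃ z).trans (h2 z),
                fun z hz c1 c2 c3 => ?_⟩
              rcases Nat.lt_succ_iff_lt_or_eq.1 hz with hz | rfl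
              · exact (hm₃ z hz c1 c2 c3).trans (h2 x)
              · exact (hle₃ z).trans (h3 c1 c2 c3))
          rw [k₂.reg0] at key₂
          obtain ⟨c1, c2, c3⟩ := key₂
          refine ⟨c1, fun z => (hle₂ z).trans (c2 z), fun z hz y hy => ?_⟩
          rcases Nat.lt_succ_iff_lt_or_eq.1 hz with hz | rfl
          · exact (hm z hz y hy).trans (c2 z)
          · rcases hy with hy | ⟨w, hw, d1, d2, d3, d4⟩
            · exact ((ht z hx y hy).trans (hle₂ z)).trans (c2 z)
            · exact ((ht w hw y d4).trans (hle₂ w)).trans (c3 w hw d1 d2 d3))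
      rw [k₁.reg0] at key₁
      exact ⟨key₁.1, key₁.2.2⟩)
  rw [h.reg0] at key
  exact .of_near hA key.2 key.1.2

open Classical in
theorem run_update (h : Consts n Q A X s) (hi : Indices Q i j l s)
    (h13 : s.reg 13 = i * (Q * n) + j * n) (h12 : s.reg 12 = Nat.count (CutSet X i j l) n)
    (h8 : ∀ y < n, CutSet X i j l y → s.arr 8 y = Nat.count (CutSet X i j l) y)
    (h10 : ∀ y < n, ¬X l y → s.arr 10 y = restCol (s.table n Q 6) (s.table n Q 7) i j l y) :
    (∀ y < n, (Stm.update.run s).table n Q 6 i j y =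
        newVal n X (s.table n Q 6) (s.arr 9) i j l y ∧
      (Stm.update.run s).table n Q 7 i j y =
        newCol n X (s.table n Q 6) (s.table n Q 7) (s.arr 9) i j l y) ∧
    ∀ a, (∀ y < n, a ≠ i * (Q * n) + j * n + y) →
      (Stm.update.run s).arr 6 a = s.arr 6 a ∧ (Stm.update.run s).arr 7 a = s.arr 7 a := by
  have key := Stm.run_iter (x := 8) (b := 0)
    (p := .ite (.sub (.lit 1) (.add (famExpr 5 8) (famExpr 6 8)))
      (.ite (.sub (.get 6 (.add (.reg 13) (.reg 8))) (.add (.reg 12) (.get 9 (.reg 8))))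
        (.seq (.put 6 (.add (.reg 13) (.reg 8)) (.add (.reg 12) (.get 9 (.reg 8))))
          (.ite (famExpr 7 8)
            (.put 7 (.add (.reg 13) (.reg 8)) (.add (.get 9 (.reg 8)) (.get 8 (.reg 8))))
            (.put 7 (.add (.reg 13) (.reg 8)) (.get 10 (.reg 8))))) .skip) .skip)
    (s := s)
    (fun m s' => (∀ y < m, s'.table n Q 6 i j y =
          newVal n X (s.table n Q 6) (s.arr 9) i j l y ∧
        s'.table n Q 7 i j y =
          newCol n X (s.table n Q 6) (s.table n Q 7) (s.arr 9) i j l y) ∧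
      ∀ a, (∀ y < m, a ≠ i * (Q * n) + j * n + y) → s'.arr 6 a = s.arr 6 a ∧ s'.arr 7 a = s.arr 7 a)
    (by decide) ⟨by simp, fun _ _ => ⟨rfl, rfl⟩⟩
    (by
      intro m hm s' hx hs ⟨h1, h2⟩
      rw [h.reg0] at hm
      have hc := h.agree hs
      obtain ⟨e5, e6, e7⟩ := hc.eval_fam (hi.agree hs) hx hm
      have r13 := (hs.reg 13 (by decide)).trans h13
      have r12 := (hs.reg 12 (by decide)).trans h12
      have a8 := hs.arr 8 (by decide)
      have a9 := hs.arr 9 (by decide)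
      have a10 := hs.arr 10 (by decide)
      obtain ⟨a6, a7⟩ := h2 (i * (Q * n) + j * n + m) (fun y hy => by omega)
      have hU : (1 - ((if X i m then 1 else 0) + if X j m then 1 else 0) ≠ 0) ↔ Free X i j m := by
        by_cases c2 : X i m <;> by_cases c3 : X j m <;> simp [Free, c2, c3]
      have hsub : ∀ a b : ℕ, (a - b ≠ 0) ↔ b < a := fun a b => by omega
      have hl : ((if X l m then 1 else 0) ≠ 0) ↔ X l m := by by_cases c : X l m <;> simp [c]
      have hcase : ∀ S : State, (∀ a, a ≠ i * (Q * n) + j * n + m →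
            S.arr 6 a = s'.arr 6 a ∧ S.arr 7 a = s'.arr 7 a) →
          S.table n Q 6 i j m = newVal n X (s.table n Q 6) (s.arr 9) i j l m →
          S.table n Q 7 i j m =
            newCol n X (s.table n Q 6) (s.table n Q 7) (s.arr 9) i j l m →
          (∀ y < m + 1, S.table n Q 6 i j y =
              newVal n X (s.table n Q 6) (s.arr 9) i j l y ∧
            S.table n Q 7 i j y =
              newCol n X (s.table n Q 6) (s.table n Q 7) (s.arr 9) i j l y) ∧
          ∀ a, (∀ y < m + 1, a ≠ i * (Q * n) + j * n + y) →
            S.arr 6 a = s.arr 6 a ∧ S.arr 7 a = s.arr 7 a := by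
        intro S hS h6 h7
        refine ⟨fun y hy => ?_, fun a ha => ?_⟩
        · rcases Nat.lt_succ_iff_lt_or_eq.1 hy with hy | rfl
          · obtain ⟨c1, c2⟩ := hS (i * (Q * n) + j * n + y) (by omega)
            obtain ⟨d1, d2⟩ := h1 y hy
            exact ⟨c1.trans d1, c2.trans d2⟩
          · exact ⟨h6, h7⟩
        · obtain ⟨c1, c2⟩ := hS a (ha m (by omega))
          obtain ⟨d1, d2⟩ := h2 a fun y hy => ha y (by omega)
          exact ⟨c1.trans d1, c2.trans d2⟩
      have e7' : ∀ c, (famExpr 7 8).eval (s'.setArr 6 (i * (Q * n) + j * n + m) c) =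
          if X l m then 1 else 0 := fun c => e7
      have hb6 : s'.arr 6 (i * (Q * n) + j * n + m) = s.table n Q 6 i j m := a6
      have hb7 : s'.arr 7 (i * (Q * n) + j * n + m) = s.table n Q 7 i j m := a7
      simp only [Stm.run, Expr.eval, e5, e6, e7', r13, r12, hx, a9, hU, hl, hsub, hb6]
      by_cases c1 : Free X i j m
      swap
      · rw [if_neg c1]
        refine hcase _ (fun _ _ => ⟨rfl, rfl⟩) ?_ ?_
        · simp only [newVal, c1, false_and, if_false]; exact hb6
        · simp only [newCol, c1, false_and, if_false]; exact hb7
      rw [if_pos c1]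
      by_cases c2 : Nat.count (CutSet X i j l) n + s.arr 9 m < s.table n Q 6 i j m
      swap
      · rw [if_neg c2]
        refine hcase _ (fun _ _ => ⟨rfl, rfl⟩) ?_ ?_
        · simp only [newVal, c1, c2, and_false, if_false]; exact hb6
        · simp only [newCol, c1, c2, and_false, if_false]; exact hb7
      rw [if_pos c2]
      by_cases c3 : X l m
      · rw [if_pos c3]
        refine hcase _ (fun a ha => ?_) ?_ ?_
        · simp [State.setReg, State.setArr, ha, r13, hx]
        · rw [newVal, if_pos ⟨c1, c2⟩]
          simp [State.table, State.setReg, State.setArr]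
        · rw [newCol, if_pos ⟨c1, c2⟩, if_pos c3, ← h8 m hm ⟨c3, c1⟩]
          simp [State.table, State.setReg, State.setArr, a8, a9, hx, r13]
      · rw [if_neg c3]
        refine hcase _ (fun a ha => ?_) ?_ ?_
        · simp [State.setReg, State.setArr, ha, r13, hx]
        · rw [newVal, if_pos ⟨c1, c2⟩]
          simp [State.table, State.setReg, State.setArr]
        · rw [newCol, if_pos ⟨c1, c2⟩, if_neg c3, ← h10 m hm c3]
          simp [State.table, State.setReg, State.setArr, a10, hx, r13])
  rw [h.reg0] at key
  exact key

end

end RAM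

/-! ### Rounds of relaxations -/

namespace RAM

theorem address_inj {Q n i j i' j' x x' : ℕ} (hj : j < Q) (hj' : j' < Q) (hx : x < n) (hx' : x' < n)
    (h : i * (Q * n) + j * n + x = i' * (Q * n) + j' * n + x') : i = i' ∧ j = j' := by
  have key : ∀ {a b c d m : ℕ}, c < m → d < m → a * m + c = b * m + d → a = b ∧ c = d := by
    intro a b c d m hc hd h
    have h1 := congrArg (· / m) h
    have h2 := congrArg (· % m) h
    have hm : 0 < m := by omega
    simp only [Nat.mul_comm _ m, Nat.mul_add_div hm, Nat.div_eq_of_lt hc, Nat.div_eq_of_lt hd,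
      Nat.mul_add_mod, Nat.mod_eq_of_lt hc, Nat.mod_eq_of_lt hd] at h1 h2
    exact ⟨by omega, h2⟩
  have h1 : (i * Q + j) * n + x = (i' * Q + j') * n + x' := by
    calc _ = i * (Q * n) + j * n + x := by ring
      _ = _ := h
      _ = _ := by ring
  exact key hj hj' (key hx hx' h1).1

theorem _root_.IsSpread.congr {n : ℕ} {A : ℕ → ℕ → Prop} {U : ℕ → Prop} {g g' M : ℕ → ℕ} (h : IsSpread n A U g M)
    (hg : ∀ x < n, g x = g' x) : IsSpread n A U g' M :=
  ⟨fun x hx => hg x hx ▸ h.le x hx, h.const, fun Z hZ m hm =>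
    h.bound Z hZ m fun x hx hxZ => hg x hx ▸ hm x hx hxZ⟩

theorem Agree.table {n Q : ℕ} {rs as : List ℕ} {s s' : State} (h : Agree rs as s s') {a : ℕ} (ha : a ∉ as) :
    s'.table n Q a = s.table n Q a := by
  funext i j x
  simp only [State.table, h.arr a ha]

section

variable {n Q : ℕ} {A X : ℕ → ℕ → Prop} [∀ x, DecidablePred (A x)] [∀ x, DecidablePred (X x)]
  {s : State} {i j l : ℕ}

/-- The data read from the rows (i, l) and (l, j) are copied to scratch arrays before the row (i, j)
is written. So the formulas refer to the old tables even if these rows coincide. -/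
theorem run_relax (hA : ∀ x y, A x y → A y x) (h : Consts n Q A X s) (hi : Indices Q i j l s)
    (hnQ : n ≤ Q) :
    ∃ M, IsSpread n A (Free X i j) (restVal X (s.table n Q 6) i j l) M ∧
      (∀ y < n, (Stm.relax.run s).table n Q 6 i j y = newVal n X (s.table n Q 6) M i j l y ∧
        (Stm.relax.run s).table n Q 7 i j y =
          newCol n X (s.table n Q 6) (s.table n Q 7) M i j l y) ∧
      ∀ i' < Q, ∀ j' < Q, (i', j') ≠ (i, j) → ∀ y < n,
        (Stm.relax.run s).table n Q 6 i' j' y = s.table n Q 6 i' j' y ∧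
        (Stm.relax.run s).table n Q 7 i' j' y = s.table n Q 7 i' j' y := by
  obtain ⟨s₁, hs₁⟩ : ∃ s₁, Stm.bases.run s = s₁ := ⟨_, rfl⟩
  obtain ⟨s₂, hs₂⟩ : ∃ s₂, Stm.cutRank.run s₁ = s₂ := ⟨_, rfl⟩
  obtain ⟨s₃, hs₃⟩ : ∃ s₃, Stm.rest.run s₂ = s₃ := ⟨_, rfl⟩
  obtain ⟨s₄, hs₄⟩ : ∃ s₄, Stm.spread.run s₃ = s₄ := ⟨_, rfl⟩
  have hrun : Stm.relax.run s = Stm.update.run s₄ := by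
    simp only [Stm.relax, Stm.run, hs₁, hs₂, hs₃, hs₄]
  have g₁ : Agree Stm.bases.regs Stm.bases.arrs s s₁ := hs₁ ▸ Stm.run_agree _ _
  have g₂ : Agree Stm.cutRank.regs Stm.cutRank.arrs s₁ s₂ := hs₂ ▸ Stm.run_agree _ _
  have g₃ : Agree Stm.rest.regs Stm.rest.arrs s₂ s₃ := hs₃ ▸ Stm.run_agree _ _
  have g₄ : Agree Stm.spread.regs Stm.spread.arrs s₃ s₄ := hs₄ ▸ Stm.run_agree _ _
  have k₁ := h.agree g₁
  have i₁ := hi.agree g₁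
  have k₂ := k₁.agree g₂
  have i₂ := i₁.agree g₂
  have k₃ := k₂.agree g₃
  have i₃ := i₂.agree g₃
  have k₄ := k₃.agree g₄
  have i₄ := i₃.agree g₄
  have b₁ : s₁.reg 13 = i * (Q * n) + j * n ∧ s₁.reg 14 = i * (Q * n) + l * n ∧
      s₁.reg 15 = l * (Q * n) + j * n := by
    rw [← hs₁]
    simp [Stm.bases, Stm.run, Expr.eval, State.setReg, hi.reg5, hi.reg6, hi.reg7,
      h.block i hi.lt5, h.block l hi.lt7, h.row j hi.lt6, h.row l hi.lt7]
  obtain ⟨b13, b14, b15⟩ := b₁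
  have t6₂ : s₂.table n Q 6 = s.table n Q 6 := (g₂.table (by decide)).trans (g₁.table (by decide))
  have t7₂ : s₂.table n Q 7 = s.table n Q 7 := (g₂.table (by decide)).trans (g₁.table (by decide))
  have t6₄ : s₄.table n Q 6 = s.table n Q 6 :=
    ((g₄.table (by decide)).trans (g₃.table (by decide))).trans t6₂
  have t7₄ : s₄.table n Q 7 = s.table n Q 7 :=
    ((g₄.table (by decide)).trans (g₃.table (by decide))).trans t7₂
  have c₂ := run_cutRank k₁ i₁
  have c₃ := run_rest k₂ i₂ ((g₂.reg 14 (by decide)).trans b14) ((g₂.reg 15 (by decide)).trans b15)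
  have c₄ := run_spread hA k₃ i₃ hnQ
  rw [hs₂] at c₂
  rw [hs₃, t6₂, t7₂] at c₃
  rw [hs₄] at c₄
  have c₅ := run_update k₄ i₄ (((g₄.reg 13 (by decide)).trans (g₃.reg 13 (by decide))).trans
      ((g₂.reg 13 (by decide)).trans b13))
    (((g₄.reg 12 (by decide)).trans (g₃.reg 12 (by decide))).trans c₂.1)
    (by rw [g₄.arr 8 (by decide), g₃.arr 8 (by decide)]; exact c₂.2)
    (by rw [g₄.arr 10 (by decide), t6₄, t7₄]; exact fun y hy => (c₃ y hy).2)
  rw [t6₄, t7₄, ← hrun] at c₅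
  refine ⟨s₄.arr 9, c₄.congr fun x hx => (c₃ x hx).1, c₅.1, fun i' hi' j' hj' hne y hy => ?_⟩
  obtain ⟨d1, d2⟩ := c₅.2 (i' * (Q * n) + j' * n + y) (fun x hx heq => by
    obtain ⟨rfl, rfl⟩ := address_inj hj' hi.lt6 hy hx heq
    exact hne rfl)
  exact ⟨d1.trans (congrFun (congrFun (congrFun t6₄ i') j') y),
    d2.trans (congrFun (congrFun (congrFun t7₄ i') j') y)⟩

/-- The constant parts of the memory are in order, and the tables hold centered colorings. -/
structure Inv (n Q : ℕ) (A X : ℕ → ℕ → Prop) [∀ x, DecidablePred (A x)]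
    [∀ x, DecidablePred (X x)] (s : State) : Prop where
  consts : Consts n Q A X s
  good : ∀ i < Q, ∀ j < Q, GoodCol n A (Free X i j) (s.table n Q 6 i j) (s.table n Q 7 i j)

/-- The table `T'` lies below `T`. -/
def TableLE (n Q : ℕ) (T' T : ℕ → ℕ → ℕ → ℕ) : Prop :=
  ∀ i < Q, ∀ j < Q, ∀ x < n, T' i j x ≤ T i j x

open Classical in
/-- The row `(i, j)` of `T'` is at least as good as what cutting at `X l` gives with `T`. -/
def Improves (n : ℕ) (A X : ℕ → ℕ → Prop) (T : ℕ → ℕ → ℕ → ℕ) (i j l : ℕ)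
    (T' : ℕ → ℕ → ℕ → ℕ) : Prop :=
  ∀ Z : ℕ → Prop, (∀ x < n, ∀ y < n, Free X i j x → Free X i j y → A x y → Z x → Z y) →
    ∀ m, (∀ x < n, Z x → ¬X l x → T i l x ≤ m ∨ T l j x ≤ m) →
      ∀ x < n, Z x → Free X i j x → T' i j x ≤ Nat.count (CutSet X i j l) n + m

/-- Rows are overwritten in the course of a round. Since entries only decrease, an improvement over
an intermediate table is one over the table at the start, and it persists to the end. -/
theorem Improves.mono {n Q : ℕ} {A X : ℕ → ℕ → Prop} {i j l : ℕ} {T T₁ T₂ T₃ : ℕ → ℕ → ℕ → ℕ} (h : Improves n A X T₁ i j l T₂)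
    (h1 : TableLE n Q T₁ T) (h2 : TableLE n Q T₃ T₂) (hi : i < Q) (hj : j < Q) (hl : l < Q) :
    Improves n A X T i j l T₃ := fun Z hZ m hm x hx hxZ hU =>
  (h2 i hi j hj x hx).trans (h Z hZ m (fun y hy hyZ hyl => (hm y hy hyZ hyl).imp
    (h1 i hi l hl y hy).trans (h1 l hl j hj y hy).trans) x hx hxZ hU)

theorem TableLE.trans {T T₁ T₂ : ℕ → ℕ → ℕ → ℕ} (h : TableLE n Q T₂ T₁) (h' : TableLE n Q T₁ T) :
    TableLE n Q T₂ T := fun i hi j hj x hx => (h i hi j hj x hx).trans (h' i hi j hj x hx)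

theorem TableLE.refl (T : ℕ → ℕ → ℕ → ℕ) : TableLE n Q T T := fun _ _ _ _ _ _ => le_rfl

theorem Inv.setReg (h : Inv n Q A X s) {x c : ℕ} (h0 : x ≠ 0) (h4 : x ≠ 4) :
    Inv n Q A X (s.setReg x c) := ⟨h.consts.setReg h0 h4, h.good⟩

theorem Inv.relax (hA : ∀ x y, A x y → A y x) (h : Inv n Q A X s) (hi : Indices Q i j l s)
    (hnQ : n ≤ Q) : Inv n Q A X (Stm.relax.run s) ∧
      TableLE n Q ((Stm.relax.run s).table n Q 6) (s.table n Q 6) ∧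
      Improves n A X (s.table n Q 6) i j l ((Stm.relax.run s).table n Q 6) := by
  obtain ⟨M, hM, h1, h2⟩ := run_relax hA h.consts hi hnQ
  refine ⟨⟨h.consts.agree (Stm.run_agree _ _), fun i' hi' j' hj' => ?_⟩,
    fun i' hi' j' hj' y hy => ?_, fun Z hZ m hm x hx hxZ hU => ?_⟩
  · by_cases hij : (i', j') = (i, j)
    · obtain ⟨rfl, rfl⟩ := Prod.mk.inj hij
      exact (goodCol_new (h.good _ hi' _ hj') (h.good _ hi' _ hi.lt7) (h.good _ hi.lt7 _ hj')
        hM).congr (fun x hx => (h1 x hx).1) fun x hx => (h1 x hx).2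
    · exact (h.good _ hi' _ hj').congr (fun x hx => (h2 i' hi' j' hj' hij x hx).1)
        fun x hx => (h2 i' hi' j' hj' hij x hx).2
  · by_cases hij : (i', j') = (i, j)
    · obtain ⟨rfl, rfl⟩ := Prod.mk.inj hij
      exact (h1 y hy).1.trans_le (newVal_le y)
    · exact ((h2 i' hi' j' hj' hij y hy).1).le
  · rw [(h1 x hx).1]
    exact newVal_le_of_bound hM hZ hm hx hxZ hU

namespace Stm

/-- Improve all rows by all cuts. -/
def round : Stm := iter 5 4 (iter 6 4 (iter 7 4 relax))

end Stm

theorem Inv.round (hA : ∀ x y, A x y → A y x) (h : Inv n Q A X s) (hnQ : n ≤ Q) :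
    Inv n Q A X (Stm.round.run s) ∧
      TableLE n Q ((Stm.round.run s).table n Q 6) (s.table n Q 6) ∧
      ∀ i < Q, ∀ j < Q, ∀ l < Q,
        Improves n A X (s.table n Q 6) i j l ((Stm.round.run s).table n Q 6) := by
  have key := Stm.run_iter (x := 5) (b := 4) (p := .iter 6 4 (.iter 7 4 Stm.relax)) (s := s)
    (fun i s' => Inv n Q A X s' ∧ TableLE n Q (s'.table n Q 6) (s.table n Q 6) ∧
      ∀ i' < i, ∀ j < Q, ∀ l < Q, Improves n A X (s.table n Q 6) i' j l (s'.table n Q 6))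
    (by decide) ⟨h.setReg (by decide) (by decide), .refl _, by simp⟩
    (by
      rintro i hi s₁ hi₁ - ⟨v₁, le₁, imp₁⟩
      rw [h.consts.reg4] at hi
      have key₁ := Stm.run_iter (x := 6) (b := 4) (p := .iter 7 4 Stm.relax) (s := s₁)
        (fun j s' => Inv n Q A X s' ∧ TableLE n Q (s'.table n Q 6) (s₁.table n Q 6) ∧
          ∀ j' < j, ∀ l < Q, Improves n A X (s₁.table n Q 6) i j' l (s'.table n Q 6))
        (by decide) ⟨v₁.setReg (by decide) (by decide), .refl _, by simp⟩
        (by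
          rintro j hj s₂ hj₂ ag₂ ⟨v₂, le₂, imp₂⟩
          rw [v₁.consts.reg4] at hj
          have key₂ := Stm.run_iter (x := 7) (b := 4) (p := Stm.relax) (s := s₂)
            (fun l s' => Inv n Q A X s' ∧ TableLE n Q (s'.table n Q 6) (s₂.table n Q 6) ∧
              ∀ l' < l, Improves n A X (s₂.table n Q 6) i j l' (s'.table n Q 6))
            (by decide) ⟨v₂.setReg (by decide) (by decide), .refl _, by simp⟩
            (by
              rintro l hl s₃ hl₃ ag₃ ⟨v₃, le₃, imp₃⟩
              rw [v₂.consts.reg4] at hl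
              have hind : Indices Q i j l s₃ := ⟨(ag₃.reg 5 (by decide)).trans
                ((ag₂.reg 5 (by decide)).trans hi₁), (ag₃.reg 6 (by decide)).trans hj₂, hl₃,
                hi, hj, hl⟩
              obtain ⟨v₄, le₄, imp₄⟩ := v₃.relax hA hind hnQ
              refine ⟨v₄.setReg (by decide) (by decide), le₄.trans le₃, fun l' hl' => ?_⟩
              rcases Nat.lt_succ_iff_lt_or_eq.1 hl' with hl' | rfl
              · exact (imp₃ l' hl').mono (.refl _) le₄ hi hj (hl'.trans hl)
              · exact imp₄.mono le₃ (.refl _) hi hj hl)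
          rw [v₂.consts.reg4] at key₂
          obtain ⟨v₄, le₄, imp₄⟩ := key₂
          refine ⟨v₄.setReg (by decide) (by decide), le₄.trans le₂, fun j' hj' l hl => ?_⟩
          rcases Nat.lt_succ_iff_lt_or_eq.1 hj' with hj' | rfl
          · exact (imp₂ j' hj' l hl).mono (.refl _) le₄ hi (hj'.trans hj) hl
          · exact (imp₄ l hl).mono le₂ (.refl _) hi hj hl)
      rw [v₁.consts.reg4] at key₁
      obtain ⟨v₄, le₄, imp₄⟩ := key₁
      refine ⟨v₄.setReg (by decide) (by decide), le₄.trans le₁, fun i' hi' j hj l hl => ?_⟩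
      rcases Nat.lt_succ_iff_lt_or_eq.1 hi' with hi' | rfl
      · exact (imp₁ i' hi' j hj l hl).mono (.refl _) le₄ (hi'.trans hi) hj hl
      · exact (imp₄ j hj l hl).mono le₁ (.refl _) hi hj hl)
  rw [h.consts.reg4] at key
  exact key

namespace Stm

/-- Improve all rows by all cuts until no more improvement is possible. -/
def rounds : Stm := iter 10 4 round

end Stm

/-- The property D, indexed by the number of rounds, keeps the interval representation out of the
reasoning about the machine. -/
theorem Inv.rounds (hA : ∀ x y, A x y → A y x) (h : Inv n Q A X s) (hnQ : n ≤ Q)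
    (D : ℕ → (ℕ → ℕ → ℕ → ℕ) → Prop) (h0 : D 0 (s.table n Q 6))
    (hD : ∀ t T T', (∀ i < Q, ∀ j < Q, ∀ l < Q, Improves n A X T i j l T') → D t T →
      D (t + 1) T') :
    Inv n Q A X (Stm.rounds.run s) ∧ D Q ((Stm.rounds.run s).table n Q 6) := by
  have key := Stm.run_iter (x := 10) (b := 4) (p := Stm.round) (s := s)
    (fun t s' => Inv n Q A X s' ∧ D t (s'.table n Q 6)) (by decide)
    ⟨h.setReg (by decide) (by decide), h0⟩
    (by
      rintro t - s₁ - - ⟨v₁, d₁⟩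
      obtain ⟨v₂, -, imp⟩ := v₁.round hA hnQ
      exact ⟨v₂.setReg (by decide) (by decide), hD t _ _ imp d₁⟩)
  rw [h.consts.reg4] at key
  exact key

end

end RAM

/-! ### Rows are at least as good as cut trees -/

namespace RAM

/-- The set `X q` consists of the vertices whose intervals contain the position `a`. -/
def IsCut {n : ℕ} (X : ℕ → ℕ → Prop) (L R : Fin n → ℕ) (q a : ℕ) : Prop :=
  ∀ x : Fin n, X q x ↔ L x ≤ a ∧ a ≤ R x

/-- The rows of `T` for regions of length at most `t + 1` are bounded by cut trees. -/
def BoundedBy {n : ℕ} (Q : ℕ) (X : ℕ → ℕ → Prop) (L R : Fin n → ℕ) (lo hi t : ℕ)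
    (T : ℕ → ℕ → ℕ → ℕ) : Prop :=
  ∀ a b m, lo ≤ a → b ≤ hi → b ≤ a + t + 1 → ∀ i < Q, ∀ j < Q, IsCut X L R i a →
    IsCut X L R j b → CutTree L R Finset.univ a b m →
      ∀ x : Fin n, a < L x → R x < b → T i j x ≤ m

/-- The root cut z of a tree splits the region into two shorter ones, whose rows are already
bounded. The relaxation of (i, j) by the set of z then attains the cost of the tree. -/
theorem BoundedBy.succ {n Q lo hi t : ℕ} {A X : ℕ → ℕ → Prop} {L R : Fin n → ℕ}
    {T T' : ℕ → ℕ → ℕ → ℕ} (hLR : ∀ x, L x ≤ R x)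
    (hA : ∀ x y : Fin n, A x y → L x ≤ R y ∧ L y ≤ R x)
    (hX : ∀ z, lo ≤ z → z ≤ hi → ∃ l < Q, IsCut X L R l z)
    (himp : ∀ i < Q, ∀ j < Q, ∀ l < Q, Improves n A X T i j l T')
    (h : BoundedBy Q X L R lo hi t T) : BoundedBy Q X L R lo hi (t + 1) T' := by
  classical
  intro a b m ha hb hab i hi' j hj hia hjb htree x hax hxb
  cases htree with
  | empty h' => exact absurd ⟨hax, hxb⟩ (h' x (Finset.mem_univ x))
  | @cut _ _ _ m' z haz hzb h₁ h₂ hm =>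
    obtain ⟨l, hl, hlz⟩ := hX z (by omega) (by omega)
    have hfree : ∀ y : Fin n, Free X i j y ↔ ¬(L y ≤ a ∧ a ≤ R y) ∧ ¬(L y ≤ b ∧ b ≤ R y) :=
      fun y => by rw [Free, hia y, hjb y]
    have hcount : Nat.count (CutSet X i j l) n ≤
        (Finset.univ.filter fun v => a < L v ∧ L v ≤ z ∧ z ≤ R v ∧ R v < b).card := by
      rw [Nat.count_eq_card_filter_range]
      refine (Finset.card_le_card fun y hy => ?_).trans (Finset.card_image_le (f := Fin.val))
      rw [Finset.mem_filter, Finset.mem_range] at hy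
      obtain ⟨hyn, hyl, hyf⟩ := hy
      have h1 := (hlz ⟨y, hyn⟩).1 hyl
      have h2 := (hfree ⟨y, hyn⟩).1 hyf
      exact Finset.mem_image.2 ⟨⟨y, hyn⟩, Finset.mem_filter.2 ⟨Finset.mem_univ _, by omega⟩, rfl⟩
    -- The closed set consists of the vertices inside the region: a neighbor that contains neither a
    -- nor b cannot leave it.
    refine (himp i hi' j hj l hl (fun y => ∃ hy : y < n, a < L ⟨y, hy⟩ ∧ R ⟨y, hy⟩ < b) ?_ m' ?_ x
      x.2 ⟨x.2, hax, hxb⟩ ((hfree x).2 (by omega))).trans (by omega)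
    · rintro y hy w hw hyf hwf hyw ⟨_, h1, h2⟩
      have h3 := hA ⟨y, hy⟩ ⟨w, hw⟩ hyw
      have h4 := (hfree ⟨w, hw⟩).1 hwf
      exact ⟨hw, by omega⟩
    · rintro y hy ⟨_, h1, h2⟩ hyl
      have h3 := (hlz ⟨y, hy⟩).not.1 hyl
      have h4 := hLR ⟨y, hy⟩
      by_cases hz : R ⟨y, hy⟩ < z
      · exact .inl (h a z m' ha (by omega) (by omega) i hi' l hl hia hlz h₁ ⟨y, hy⟩ h1 hz)
      · exact .inr (h z b m' (by omega) hb (by omega) l hl j hj hlz hjb h₂ ⟨y, hy⟩ (by omega) h2)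

theorem BoundedBy.zero {n Q lo hi : ℕ} {X : ℕ → ℕ → Prop} {L R : Fin n → ℕ}
    {T : ℕ → ℕ → ℕ → ℕ} (hLR : ∀ x, L x ≤ R x) : BoundedBy Q X L R lo hi 0 T := by
  intro a b m _ _ hab i _ j _ _ _ _ x hax hxb
  have := hLR x
  omega

/-! ### Preparing the memory and writing the output -/

namespace Stm

open RAM.Expr

/-- Put `n ^ 2` and `n ^ 2 + 1` into registers. -/
def sizes : Stm := seq (iter 8 0 (set 3 (add (reg 3) (reg 0)))) (set 4 (add (reg 3) (lit 1)))

/-- Fill the array `a` with the multiples of the register `w`, computed in the register `c`. -/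
def multiples (a c w : ℕ) : Stm :=
  iter 5 4 (seq (put a (reg 5) (reg c)) (set c (add (reg c) (reg w))))

/-- Make the adjacency relation reflexive. -/
def diagonal : Stm := iter 8 0 (put 0 (add (get 3 (reg 8)) (reg 8)) (lit 1))

/-- Compute the intersections of two closed neighborhoods. -/
def family : Stm :=
  iter 5 0 (iter 6 0 (iter 8 0 (seq
    (put 5 (reg 18) (sub (add (get 0 (add (get 3 (reg 5)) (reg 8)))
      (get 0 (add (get 3 (reg 6)) (reg 8)))) (lit 1)))
    (set 18 (add (reg 18) (lit 1))))))

/-- Start with the injective coloring in all rows of the tables. -/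
def initial : Stm :=
  iter 5 4 (iter 6 4 (iter 8 0 (seq (put 6 (reg 19) (reg 0))
    (seq (put 7 (reg 19) (reg 8)) (set 19 (add (reg 19) (lit 1)))))))

/-- Output the row for the whole graph. -/
def output : Stm :=
  iter 8 0 (seq (set 13 (add (add (get 4 (reg 3)) (get 3 (reg 3))) (reg 8)))
    (seq (put 2 (reg 8) (get 7 (reg 13)))
      (ite (sub (get 6 (reg 13)) (reg 2)) (set 2 (get 6 (reg 13))) skip)))

theorem run_sizes {n : ℕ} {s : State} (h0 : s.reg 0 = n) (h3 : s.reg 3 = 0) :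
    (sizes.run s).reg 3 = n * n ∧ (sizes.run s).reg 4 = n * n + 1 := by
  have key := run_iter (x := 8) (b := 0) (p := .set 3 (add (reg 3) (reg 0))) (s := s)
    (fun m s' => s'.reg 3 = m * n) (by decide) (by simpa [State.setReg] using h3)
    (by
      intro m _ s' _ hs h
      have e0 := (hs.reg 0 (by decide)).trans h0
      simp [run, State.setReg, Expr.eval, h, e0, Nat.succ_mul])
  rw [h0] at key
  constructor
  · simpa [sizes, run, State.setReg] using key
  · rw [sizes, run, run]
    simp [State.setReg, Expr.eval, key]

/-- The final value of the register c is used as well: after the first table it is the length of a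
block of rows, which is the stride of the second table. -/
theorem run_multiples {a c w m : ℕ} {s : State} (h5 : 5 ∉ [c, w]) (hwc : w ≠ c)
    (hc : s.reg c = 0) (hw : s.reg w = m) :
    (∀ q < s.reg 4, ((multiples a c w).run s).arr a q = q * m) ∧
      ((multiples a c w).run s).reg c = s.reg 4 * m := by
  simp only [List.mem_cons, List.not_mem_nil, or_false, not_or] at h5
  refine run_iter (x := 5) (b := 4) (s := s)
    (fun t s' => (∀ q < t, s'.arr a q = q * m) ∧ s'.reg c = t * m) (by simp [regs, h5])
    ⟨by simp, by simpa [State.setReg, Function.update_of_ne (Ne.symm h5.1)] using hc⟩ ?_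
  rintro t - s' hx hs ⟨h1, h2⟩
  have e := (hs.reg w (by simp [regs, hwc, Ne.symm h5.2])).trans hw
  refine ⟨fun q hq => ?_, ?_⟩
  · rcases Nat.lt_succ_iff_lt_or_eq.1 hq with hq | rfl
    · simpa [run, State.setReg, State.setArr, Expr.eval, hx, hq.ne] using h1 q hq
    · simp [run, State.setReg, State.setArr, Expr.eval, hx, h2]
  · simp [run, State.setReg, State.setArr, Expr.eval, h2, e, Function.update_of_ne (Ne.symm h5.1),
      Nat.succ_mul]

theorem run_diagonal {n : ℕ} {E : ℕ → ℕ → Prop} [∀ x, DecidablePred (E x)] {s : State} (h0 : s.reg 0 = n)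
    (hrow : ∀ q < n, s.arr 3 q = q * n)
    (hE : ∀ x < n, ∀ y < n, s.arr 0 (x * n + y) = if E x y then 1 else 0) :
    ∀ x < n, ∀ y < n, (diagonal.run s).arr 0 (x * n + y) = if x = y ∨ E x y then 1 else 0 := by
  have key := run_iter (x := 8) (b := 0) (p := .put 0 (add (get 3 (reg 8)) (reg 8)) (lit 1)) (s := s)
    (fun m s' => ∀ x < n, ∀ y < n,
      s'.arr 0 (x * n + y) = if x = y ∧ x < m ∨ E x y then 1 else 0) (by decide)
    (by simpa [State.setReg] using hE)
    (by
      intro m hm s' hx hs h x hxn y hyn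
      rw [h0] at hm
      have e3 := hs.arr 3 (by decide)
      by_cases hc : x = m ∧ y = m
      · obtain ⟨rfl, rfl⟩ := hc
        simp [run, State.setReg, State.setArr, Expr.eval, hx, e3, hrow _ hxn]
      · have hne : x * n + y ≠ m * n + m := by
          intro heq
          obtain ⟨h1, h2⟩ := address_inj (i := 0) (i' := 0) (Q := n) (j := x) (j' := m) hxn hm hyn
            hm (by simpa using heq)
          subst h2
          omega
        have : (x = y ∧ x < m + 1) ↔ (x = y ∧ x < m) := by omega
        simpa [run, State.setReg, State.setArr, Expr.eval, hx, e3, hrow _ hm, hne, this, -Order.lt_add_one_iff]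
          using h x hxn y hyn)
  rw [h0] at key
  intro x hx y hy
  have : (x = y ∧ x < n ∨ E x y) ↔ x = y ∨ E x y := by tauto
  simpa only [this, diagonal] using key x hx y hy

/-- The invariant rule for three nested loops. -/
theorem run_iter₃ {b₁ b₂ b₃ n₁ n₂ n₃ : ℕ} {p : Stm} {s : State} (I : ℕ → State → Prop)
    (hp : ∀ x ∈ [5, 6, 8], x ∉ p.regs) (hb : ∀ b ∈ [b₁, b₂, b₃], b ∉ 5 :: 6 :: 8 :: p.regs)
    (h₁ : s.reg b₁ = n₁) (h₂ : s.reg b₂ = n₂) (h₃ : s.reg b₃ = n₃)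
    (hI : ∀ r s x c, x ∈ [5, 6, 8] → I r s → I r (s.setReg x c)) (h0 : I 0 s)
    (hstep : ∀ i < n₁, ∀ j < n₂, ∀ x < n₃, ∀ s', s'.reg 5 = i → s'.reg 6 = j → s'.reg 8 = x →
      Agree (5 :: 6 :: 8 :: p.regs) p.arrs s s' → I ((i * n₂ + j) * n₃ + x) s' →
        I ((i * n₂ + j) * n₃ + x + 1) (p.run s')) :
    I (n₁ * n₂ * n₃) ((iter 5 b₁ (iter 6 b₂ (iter 8 b₃ p))).run s) := by
  have hp5 := hp 5 (by decide)
  have hp6 := hp 6 (by decide)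
  have hp8 := hp 8 (by decide)
  have hb2 := hb b₂ (by simp)
  have hb3 := hb b₃ (by simp)
  have key := run_iter (x := 5) (b := b₁) (p := iter 6 b₂ (iter 8 b₃ p)) (s := s)
    (fun i s' => I (i * n₂ * n₃) s') (by simpa [regs] using hp5) (hI _ _ _ _ (by decide) (by simpa))
    (by
      intro i hi s₁ hi₁ ag₁ I₁
      rw [h₁] at hi
      have key₁ := run_iter (x := 6) (b := b₂) (p := iter 8 b₃ p) (s := s₁)
        (fun j s' => I ((i * n₂ + j) * n₃) s') (by simpa [regs] using hp6)
        (hI _ _ _ _ (by decide) (by simpa))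
        (by
          intro j hj s₂ hj₂ ag₂ I₂
          rw [ag₁.reg b₂ hb2, h₂] at hj
          have key₂ := run_iter (x := 8) (b := b₃) (p := p) (s := s₂)
            (fun x s' => I ((i * n₂ + j) * n₃ + x) s') hp8 (hI _ _ _ _ (by decide) (by simpa))
            (by
              intro x hx s₃ hx₃ ag₃ I₃
              rw [ag₂.reg b₃ (List.not_mem_of_not_mem_cons hb3), ag₁.reg b₃ hb3, h₃] at hx
              refine hI _ _ _ _ (by decide) (hstep i hi j hj x hx s₃ ?_ ?_ hx₃
                ⟨fun y hy => ?_, fun a ha => ?_⟩ I₃)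
              · rw [ag₃.reg 5 (by simp [hp5]), ag₂.reg 5 (by simp [regs, hp5]), hi₁]
              · rw [ag₃.reg 6 (by simp [hp6]), hj₂]
              · have hy' := List.not_mem_of_not_mem_cons hy
                rw [ag₃.reg y (List.not_mem_of_not_mem_cons hy'), ag₂.reg y hy', ag₁.reg y hy]
              · rw [ag₃.arr a ha, ag₂.arr a ha, ag₁.arr a ha])
          rw [ag₂.reg b₃ (List.not_mem_of_not_mem_cons hb3), ag₁.reg b₃ hb3, h₃] at key₂
          refine hI _ _ _ _ (by decide) ?_
          rwa [← Nat.add_assoc, Nat.succ_mul (i * n₂ + j)])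
      rw [ag₁.reg b₂ hb2, h₂] at key₁
      refine hI _ _ _ _ (by decide) ?_
      rwa [Nat.succ_mul i])
  rwa [h₁] at key

/-- Register 18 runs through consecutive addresses, so the address a encodes the vertices a / n / n,
a / n % n and a % n. Cells from n * n * n on keep their initial 0, which makes the set with index n
* n empty. -/
theorem run_family {n : ℕ} {A : ℕ → ℕ → Prop} [∀ x, DecidablePred (A x)] {s : State}
    (h0 : s.reg 0 = n)
    (hrow : ∀ q < n, s.arr 3 q = q * n) (h18 : s.reg 18 = 0) (h5 : ∀ a, s.arr 5 a = 0)
    (hA : ∀ x < n, ∀ y < n, s.arr 0 (x * n + y) = if A x y then 1 else 0) (q x : ℕ) (hx : x < n) :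
    (family.run s).arr 5 (q * n + x) =
      if q < n * n ∧ A (q / n) x ∧ A (q % n) x then 1 else 0 := by
  have hn : 0 < n := by omega
  have key := run_iter₃ (b₁ := 0) (b₂ := 0) (b₃ := 0) (p := .seq
      (.put 5 (reg 18) (sub (add (get 0 (add (get 3 (reg 5)) (reg 8)))
        (get 0 (add (get 3 (reg 6)) (reg 8)))) (lit 1)))
      (.set 18 (add (reg 18) (lit 1)))) (s := s)
    (fun r s' => s'.reg 18 = r ∧ ∀ a, s'.arr 5 a =
      if a < r ∧ A (a / n / n) (a % n) ∧ A (a / n % n) (a % n) then 1 else 0)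
    (by decide) (by decide) h0 h0 h0
    (by
      rintro r s y c hy ⟨h1, h2⟩
      refine ⟨?_, h2⟩
      have : 18 ≠ y := by rintro rfl; simp at hy
      rw [← h1]; exact Function.update_of_ne this _ _)
    ⟨h18, by simpa using h5⟩
    (by
      rintro i hi j hj y hy s' e5 e6 e8 hs ⟨h1, h2⟩
      have e3 := hs.arr 3 (by decide)
      have e0 := hs.arr 0 (by decide)
      refine ⟨by simp [run, State.setReg, Expr.eval, State.setArr, h1], fun a => ?_⟩
      by_cases ha : a = (i * n + j) * n + y
      · have d1 : a / n = i * n + j := by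
          rw [ha, Nat.mul_comm, Nat.mul_add_div hn, Nat.div_eq_of_lt hy, Nat.add_zero]
        have d2 : a % n = y := by rw [ha, Nat.mul_comm, Nat.mul_add_mod, Nat.mod_eq_of_lt hy]
        have d3 : (i * n + j) / n = i := by
          rw [Nat.mul_comm, Nat.mul_add_div hn, Nat.div_eq_of_lt hj, Nat.add_zero]
        have d4 : (i * n + j) % n = j := by rw [Nat.mul_comm, Nat.mul_add_mod, Nat.mod_eq_of_lt hj]
        rw [d1, d2, d3, d4, ← ha]
        simp only [run, Expr.eval, State.setReg, State.setArr, h1, ← ha, Function.update_self, e5, e6,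
          e8, e3, e0, hrow i hi, hrow j hj, hA i hi y hy, hA j hj y hy]
        by_cases c1 : A i y <;> by_cases c2 : A j y <;> simp [c1, c2]
      · have : a < (i * n + j) * n + y + 1 ↔ a < (i * n + j) * n + y := by omega
        simp only [this]
        rw [← h2 a]
        simp [run, Expr.eval, State.setReg, State.setArr, h1, ha])
  have d1 : (q * n + x) / n = q := by
    rw [Nat.mul_comm, Nat.mul_add_div hn, Nat.div_eq_of_lt hx, Nat.add_zero]
  have d2 : (q * n + x) % n = x := by rw [Nat.mul_comm, Nat.mul_add_mod, Nat.mod_eq_of_lt hx]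
  have d3 : q * n + x < n * n * n ↔ q < n * n := by
    constructor
    · intro h
      exact lt_of_mul_lt_mul_right (Nat.lt_of_le_of_lt (Nat.le_add_right _ _) h) (Nat.zero_le n)
    · intro h
      calc q * n + x < q * n + n := by omega
        _ = (q + 1) * n := by ring
        _ ≤ n * n * n := Nat.mul_le_mul_right n h
  have := key.2 (q * n + x)
  rw [d1, d2] at this
  simpa only [d3, family] using this

theorem run_initial {n Q : ℕ} {s : State} (h0 : s.reg 0 = n) (h4 : s.reg 4 = Q)
    (h19 : s.reg 19 = 0) {i j x : ℕ} (hi : i < Q) (hj : j < Q) (hx : x < n) :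
    (initial.run s).table n Q 6 i j x = n ∧ (initial.run s).table n Q 7 i j x = x := by
  have hn : 0 < n := by omega
  have key := run_iter₃ (b₁ := 4) (b₂ := 4) (b₃ := 0) (p := .seq (.put 6 (reg 19) (reg 0))
      (.seq (.put 7 (reg 19) (reg 8)) (.set 19 (add (reg 19) (lit 1))))) (s := s)
    (fun r s' => s'.reg 19 = r ∧ ∀ a < r, s'.arr 6 a = n ∧ s'.arr 7 a = a % n)
    (by decide) (by decide) h4 h4 h0
    (by
      rintro r s y c hy ⟨h1, h2⟩
      refine ⟨?_, h2⟩
      have : 19 ≠ y := by rintro rfl; simp at hy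
      rw [← h1]; exact Function.update_of_ne this _ _)
    ⟨h19, by simp⟩
    (by
      rintro i hi j hj y hy s' e5 e6 e8 hs ⟨h1, h2⟩
      have e0 := (hs.reg 0 (by decide)).trans h0
      refine ⟨by simp [run, State.setReg, Expr.eval, State.setArr, h1], fun a ha => ?_⟩
      rcases Nat.lt_succ_iff_lt_or_eq.1 ha with ha | rfl
      · simpa [run, Expr.eval, State.setReg, State.setArr, h1, ha.ne] using h2 a ha
      · rw [Nat.mul_comm (i * Q + j), Nat.mul_add_mod, Nat.mod_eq_of_lt hy]
        simp [run, Expr.eval, State.setReg, State.setArr, h1, e0, e8, Nat.mul_comm n])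
  have e : i * (Q * n) + j * n + x = (i * Q + j) * n + x := by ring
  have hlt : (i * Q + j) * n + x < Q * Q * n := by
    have h1 : i * Q + j + 1 ≤ Q * Q := by
      calc i * Q + j + 1 ≤ i * Q + Q := by omega
        _ = (i + 1) * Q := by ring
        _ ≤ Q * Q := Nat.mul_le_mul_right Q hi
    calc (i * Q + j) * n + x < (i * Q + j) * n + n := by omega
      _ = (i * Q + j + 1) * n := by ring
      _ ≤ Q * Q * n := Nat.mul_le_mul_right n h1
  have := key.2 _ hlt
  rw [Nat.mul_comm _ n, Nat.mul_add_mod, Nat.mod_eq_of_lt hx, Nat.mul_comm n] at this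
  simpa only [State.table, e, initial] using this

theorem run_output {n Q : ℕ} {A X : ℕ → ℕ → Prop} [∀ x, DecidablePred (A x)]
    [∀ x, DecidablePred (X x)] {s : State} {q : ℕ} (h : Consts n Q A X s) (h2 : s.reg 2 = 0)
    (h3 : s.reg 3 = q) (hq : q < Q) :
    (∀ x < n, (output.run s).arr 2 x = s.table n Q 7 q q x ∧
      s.table n Q 6 q q x ≤ (output.run s).reg 2) ∧
    ∀ m, (∀ x < n, s.table n Q 6 q q x ≤ m) → (output.run s).reg 2 ≤ m := by
  have key := run_iter (x := 8) (b := 0)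
    (p := .seq (.set 13 (add (add (get 4 (reg 3)) (get 3 (reg 3))) (reg 8)))
      (.seq (.put 2 (reg 8) (get 7 (reg 13)))
        (.ite (sub (get 6 (reg 13)) (reg 2)) (.set 2 (get 6 (reg 13))) .skip))) (s := s)
    (fun m s' => (∀ x < m, s'.arr 2 x = s.table n Q 7 q q x ∧ s.table n Q 6 q q x ≤ s'.reg 2) ∧
      ∀ m, (∀ x < n, s.table n Q 6 q q x ≤ m) → s'.reg 2 ≤ m)
    (by decide) ⟨by simp, by simp [State.setReg, h2]⟩
    (by
      rintro m hm s' hx hs ⟨g1, g2⟩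
      rw [h.reg0] at hm
      have hc := h.agree hs
      have e3 := (hs.reg 3 (by decide)).trans h3
      have a6 := hs.arr 6 (by decide)
      have a7 := hs.arr 7 (by decide)
      have e : s'.arr 4 q + s'.arr 3 q + m = q * (Q * n) + q * n + m := by
        rw [hc.block q hq, hc.row q hq]
      have hsub : ∀ a b : ℕ, (a - b ≠ 0) ↔ b < a := fun a b => by omega
      have t6 : s.arr 6 (q * (Q * n) + q * n + m) = s.table n Q 6 q q m := rfl
      have t7 : s.arr 7 (q * (Q * n) + q * n + m) = s.table n Q 7 q q m := rfl
      simp only [run, Expr.eval, hsub]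
      split_ifs with hlt <;>
      simp [State.setReg, State.setArr, e3, hx, e, a6, t6, a7, t7] at hlt ⊢
      · refine ⟨fun y hy => ?_, fun m' hm' => hm' m hm⟩
        rcases hy.lt_or_eq with hy | rfl
        · obtain ⟨d1, d2⟩ := g1 y hy
          exact ⟨by rw [Function.update_of_ne hy.ne, d1], d2.trans hlt.le⟩
        · simp
      · refine ⟨fun y hy => ?_, g2⟩
        rcases hy.lt_or_eq with hy | rfl
        · obtain ⟨d1, d2⟩ := g1 y hy
          exact ⟨by rw [Function.update_of_ne hy.ne, d1], d2⟩
        · exact ⟨by simp, hlt⟩)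
  rw [h.reg0] at key
  exact key

end Stm

end RAM

/-! ### Correctness of the whole program -/

namespace RAM

namespace Stm

/-- Prepare the constant data and the tables. -/
def setup : Stm :=
  seq (multiples 3 16 0) (seq (multiples 4 17 16) (seq diagonal (seq family initial)))

/-- The program, after the sizes have been computed. -/
def main : Stm := seq setup (seq rounds output)

end Stm

/-- The intersections of two closed neighborhoods, indexed by numbers below `n * n`; the remaining
indices give the empty set. -/
def Inter (n : ℕ) (A : ℕ → ℕ → Prop) (q x : ℕ) : Prop := q < n * n ∧ A (q / n) x ∧ A (q % n) x

theorem not_inter_sq (n : ℕ) (A : ℕ → ℕ → Prop) (x : ℕ) : ¬Inter n A (n * n) x :=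
  fun h => lt_irrefl _ h.1

theorem inv_setup {n : ℕ} {A E : ℕ → ℕ → Prop} [∀ x, DecidablePred (A x)]
    [∀ x, DecidablePred (E x)] [∀ x, DecidablePred (Inter n A x)] (hA : ∀ x y, A x y ↔ x = y ∨ E x y) {s : State} (h0 : s.reg 0 = n)
    (h4 : s.reg 4 = n * n + 1) (hr : ∀ x ∈ [16, 17, 18, 19], s.reg x = 0) (h5 : ∀ a, s.arr 5 a = 0)
    (hE : ∀ x < n, ∀ y < n, s.arr 0 (x * n + y) = if E x y then 1 else 0) :
    Inv n (n * n + 1) A (Inter n A) (Stm.setup.run s) := by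
  obtain ⟨s₁, hs₁⟩ : ∃ s₁, (Stm.multiples 3 16 0).run s = s₁ := ⟨_, rfl⟩
  obtain ⟨s₂, hs₂⟩ : ∃ s₂, (Stm.multiples 4 17 16).run s₁ = s₂ := ⟨_, rfl⟩
  obtain ⟨s₃, hs₃⟩ : ∃ s₃, Stm.diagonal.run s₂ = s₃ := ⟨_, rfl⟩
  obtain ⟨s₄, hs₄⟩ : ∃ s₄, Stm.family.run s₃ = s₄ := ⟨_, rfl⟩
  have hrun : Stm.setup.run s = Stm.initial.run s₄ := by
    simp only [Stm.setup, Stm.run, hs₁, hs₂, hs₃, hs₄]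
  have g₁ : Agree [5, 16] [3] s s₁ := hs₁ ▸ Stm.run_agree (Stm.multiples 3 16 0) s
  have g₂ : Agree [5, 17] [4] s₁ s₂ := hs₂ ▸ Stm.run_agree (Stm.multiples 4 17 16) s₁
  have g₃ : Agree [8] [0] s₂ s₃ := hs₃ ▸ Stm.run_agree Stm.diagonal s₂
  have g₄ : Agree [5, 6, 8, 18] [5] s₃ s₄ := hs₄ ▸ Stm.run_agree Stm.family s₃
  have g₅ : Agree [5, 6, 8, 19] [6, 7] s₄ (Stm.initial.run s₄) := Stm.run_agree Stm.initial s₄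
  have hreg : ∀ x, x ∉ [5, 6, 8, 16, 17, 18] → s₁.reg x = s.reg x ∧ s₂.reg x = s.reg x ∧
      s₃.reg x = s.reg x ∧ s₄.reg x = s.reg x := by
    intro x hx
    simp only [List.mem_cons, List.not_mem_nil, or_false, not_or] at hx
    have e₁ := g₁.reg x (by simp [hx])
    have e₂ := (g₂.reg x (by simp [hx])).trans e₁
    have e₃ := (g₃.reg x (by simp [hx])).trans e₂
    exact ⟨e₁, e₂, e₃, (g₄.reg x (by simp [hx])).trans e₃⟩
  obtain ⟨z₁, z₂, z₃, z₄⟩ := hreg 0 (by decide)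
  obtain ⟨f₁, f₂, f₃, f₄⟩ := hreg 4 (by decide)
  rw [h0] at z₁ z₂ z₃ z₄
  rw [h4] at f₁ f₂ f₃ f₄
  have hnQ : n < n * n + 1 := Nat.lt_succ_of_le (Nat.le_mul_self n)
  obtain ⟨r₁, r₁'⟩ := Stm.run_multiples (a := 3) (c := 16) (w := 0) (s := s) (by decide) (by decide)
    (hr 16 (by decide)) h0
  rw [hs₁, h4] at r₁ r₁'
  obtain ⟨r₂, -⟩ := Stm.run_multiples (a := 4) (c := 17) (w := 16) (s := s₁) (by decide) (by decide)
    ((g₁.reg 17 (by decide)).trans (hr 17 (by decide))) r₁'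
  rw [hs₂, f₁] at r₂
  have r₃ := Stm.run_diagonal (E := E) z₂ (by
    intro q hq
    rw [g₂.arr 3 (by decide)]
    exact r₁ q (hq.trans hnQ)) (by
    rw [g₂.arr 0 (by decide), g₁.arr 0 (by decide)]
    exact hE)
  rw [hs₃] at r₃
  have r₄ := Stm.run_family (A := A) z₃ (by
    intro q hq
    rw [g₃.arr 3 (by decide), g₂.arr 3 (by decide)]
    exact r₁ q (hq.trans hnQ))
    (by rw [g₃.reg 18 (by decide), g₂.reg 18 (by decide), g₁.reg 18 (by decide)]
        exact hr 18 (by decide))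
    (by rw [g₃.arr 5 (by decide), g₂.arr 5 (by decide), g₁.arr 5 (by decide)]; exact h5)
    (fun x hx y hy => (r₃ x hx y hy).trans (if_congr (hA x y).symm rfl rfl))
  rw [hs₄] at r₄
  have r₅ := fun i hi j hj x hx => Stm.run_initial z₄ f₄ (by
    rw [(hreg 19 (by decide)).2.2.2]; exact hr 19 (by decide)) (i := i) (j := j) (x := x) hi hj hx
  rw [← hrun] at g₅ r₅
  refine ⟨⟨(g₅.reg 0 (by decide)).trans z₄, (g₅.reg 4 (by decide)).trans f₄, ?_, ?_, ?_, ?_⟩, ?_⟩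
  · rw [g₅.arr 3 (by decide), g₄.arr 3 (by decide), g₃.arr 3 (by decide), g₂.arr 3 (by decide)]
    exact r₁
  · rw [g₅.arr 4 (by decide), g₄.arr 4 (by decide), g₃.arr 4 (by decide)]
    exact r₂
  · rw [g₅.arr 0 (by decide), g₄.arr 0 (by decide)]
    intro x hx y hy
    exact (r₃ x hx y hy).trans (if_congr (hA x y).symm rfl rfl)
  · rw [g₅.arr 5 (by decide)]
    intro q _ x hx
    exact (r₄ q x hx).trans (if_congr Iff.rfl rfl rfl)
  · intro i hi j hj
    have : GoodCol n A (Free (Inter n A) i j) (fun _ => n) id :=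
      ⟨fun _ _ _ _ _ _ _ => rfl, fun x hx _ => hx, fun S hS _ _ => by
        obtain ⟨x, hx⟩ := hS
        exact ⟨x, hx, fun y _ hyx => hyx⟩⟩
    exact this.congr (fun x hx => (r₅ i hi j hj x hx).1) fun x hx => (r₅ i hi j hj x hx).2

/-- The index n * n of the empty set takes care of the positions that no interval meets. -/
theorem exists_isCut {n N : ℕ} {G : SimpleGraph (Fin n)} {A : ℕ → ℕ → Prop} {L R : Fin n → ℕ}
    (hA : ∀ x y : Fin n, A x y ↔ x = y ∨ G.Adj x y) (hLR : ∀ v, 2 ≤ L v ∧ R v ≤ 2 * N)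
    (hcut : ∀ p, 2 ≤ p → p ≤ 2 * N → ∃ i j, ∀ x, (L x ≤ p ∧ p ≤ R x) ↔
      (i = x ∨ G.Adj i x) ∧ (j = x ∨ G.Adj j x)) (z : ℕ) :
    ∃ l < n * n + 1, IsCut (Inter n A) L R l z := by
  by_cases hz : 2 ≤ z ∧ z ≤ 2 * N
  · obtain ⟨i, j, hij⟩ := hcut z hz.1 hz.2
    have hn : 0 < n := i.pos
    have hlt : (i : ℕ) * n + j < n * n := by
      calc (i : ℕ) * n + j < i * n + n := by omega
        _ = (i + 1) * n := by ring
        _ ≤ n * n := Nat.mul_le_mul_right n i.2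
    refine ⟨i * n + j, hlt.trans (Nat.lt_succ_self _), fun x => ?_⟩
    have h1 : ((i : ℕ) * n + j) / n = i := by
      rw [Nat.mul_comm, Nat.mul_add_div hn, Nat.div_eq_of_lt j.2, Nat.add_zero]
    have h2 : ((i : ℕ) * n + j) % n = j := by rw [Nat.mul_comm, Nat.mul_add_mod, Nat.mod_eq_of_lt j.2]
    rw [hij x, Inter, h1, h2, hA, hA]
    exact and_iff_right hlt
  · refine ⟨n * n, Nat.lt_succ_self _, fun x => iff_of_false (not_inter_sq n A x) ?_⟩
    have := hLR x
    omega

/-- The vertex set of a connected subgraph is linked, because a property that passes along edges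
passes along walks of the subgraph. -/
theorem isCenteredColoring_of_goodCol {n m : ℕ} {G : SimpleGraph (Fin n)} {A : ℕ → ℕ → Prop}
    {U : ℕ → Prop} {v c : ℕ → ℕ} (hA : ∀ x y : Fin n, G.Adj x y → A x y) (hU : ∀ x, U x)
    (h : GoodCol n A U v c) (φ : Fin n → Fin m) (hφ : ∀ x : Fin n, c x = φ x) :
    IsCenteredColoring G φ := by
  intro H hH
  have hlink : Linked A (Fin.val '' H.verts) := by
    rintro P hP _ ⟨x, hx, rfl⟩ _ ⟨y, hy, rfl⟩ hPx
    have key : ∀ {u w : H.verts}, H.coe.Walk u w → P (u : Fin n) → P (w : Fin n) := by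
      intro u w p
      induction p with
      | nil => exact id
      | @cons u z w hadj p ih =>
        exact fun hu => ih (hP _ ⟨u, u.2, rfl⟩ _ ⟨z, z.2, rfl⟩
          (hA _ _ (H.adj_sub hadj)) hu)
    obtain ⟨p⟩ := hH.coe.preconnected ⟨x, hx⟩ ⟨y, hy⟩
    exact key p hPx
  obtain ⟨x, hx, hxc⟩ := h.center (Fin.val '' H.verts) (hH.nonempty.image _)
    (by rintro _ ⟨x, -, rfl⟩; exact ⟨x.2, hU x⟩) hlink
  obtain ⟨w, hw, rfl⟩ := hx
  exact ⟨w, hw, fun u hu huw => Fin.ext (hxc u ⟨u, hu, rfl⟩ (by rw [hφ, hφ, huw]))⟩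

end RAM

theorem theorem3 :
    ∃ (A : RAM.Prog) (T : Polynomial ℕ),
      ∀ (n k : ℕ) (G : SimpleGraph (Fin n)) (ψ : Fin n → Fin k),
        IsIntervalGraph G → IsLinearColoring G ψ →
          ∃ (s : RAM.State) (t : ℕ),
            RAM.Exec A (RAM.input G ψ) s t ∧ t ≤ T.eval n ∧
              ∃ (m : ℕ) (φ : Fin n → Fin m),
                m ≤ k ^ 2 ∧ IsCenteredColoring G φ ∧ RAM.Outputs s φ := by
  open RAM in
  classical
  -- The sizes are computed separately because n² + 1 becomes a loop bound in `Stm.main`, where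
  -- bounds must not be written. All loops there run at most n² + 1 times, whence the composition.
  refine ⟨.seq Stm.sizes.compile Stm.main.compile,
    Stm.sizes.time + Stm.main.time.comp (.X * .X + 1), fun n k G ψ hG hψ => ?_⟩
  obtain ⟨s₁, hs₁⟩ : ∃ s₁, Stm.sizes.run (input G ψ) = s₁ := ⟨_, rfl⟩
  obtain ⟨s₂, hs₂⟩ : ∃ s₂, Stm.setup.run s₁ = s₂ := ⟨_, rfl⟩
  obtain ⟨s₃, hs₃⟩ : ∃ s₃, Stm.rounds.run s₂ = s₃ := ⟨_, rfl⟩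
  have hin : (input G ψ).reg 0 = n := by simp [input]
  obtain ⟨h3, h4⟩ := Stm.run_sizes hin (by simp [input])
  have g₁ : Agree [8, 3, 4] [] (input G ψ) s₁ := hs₁ ▸ Stm.run_agree Stm.sizes _
  have g₂ : Agree Stm.setup.regs Stm.setup.arrs s₁ s₂ := hs₂ ▸ Stm.run_agree _ _
  have g₃ : Agree Stm.rounds.regs Stm.rounds.arrs s₂ s₃ := hs₃ ▸ Stm.run_agree _ _
  rw [hs₁] at h3 h4
  have h0 := (g₁.reg 0 (by decide)).trans hin
  let E : ℕ → ℕ → Prop := fun x y => ∃ (hx : x < n) (hy : y < n), G.Adj ⟨x, hx⟩ ⟨y, hy⟩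
  let A : ℕ → ℕ → Prop := fun x y => x = y ∨ E x y
  have hA : ∀ x y : Fin n, A x y ↔ x = y ∨ G.Adj x y := fun x y => by
    simp [A, E, Fin.ext_iff]
  have hsymm : ∀ x y, A x y → A y x := by
    rintro x y (rfl | ⟨hx, hy, h⟩)
    · exact .inl rfl
    · exact .inr ⟨hy, hx, h.symm⟩
  have inv₂ : Inv n (n * n + 1) A (Inter n A) s₂ := by
    rw [← hs₂]
    refine inv_setup (E := E) (fun _ _ => Iff.rfl) h0 h4 ?_ ?_ ?_
    · intro x hx
      rw [g₁.reg x (by revert x; decide)]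
      have : x ≠ 0 ∧ x ≠ 1 := by revert x; decide
      simp [input, this]
    · intro a
      rw [g₁.arr 5 (by decide)]
      simp [input]
    · intro x hx y hy
      rw [g₁.arr 0 (by decide)]
      have : (∃ i j : Fin n, x * n + y = (i : ℕ) * n + (j : ℕ) ∧ G.Adj i j) ↔ E x y := by
        constructor
        · rintro ⟨i, j, hij, hadj⟩
          obtain ⟨d1, d2⟩ := address_inj (i := 0) (i' := 0) (Q := n) (n := n) hx i.2 hy j.2
            (by simpa using hij)
          have d3 : y = j := by subst d2; omega
          subst d2 d3
          exact ⟨hx, hy, hadj⟩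
        · rintro ⟨hx, hy, h⟩
          exact ⟨_, _, rfl, h⟩
      simp only [input, if_true]
      exact if_congr this rfl rfl
  have hQ : n ≤ n * n + 1 := (Nat.le_mul_self n).trans (Nat.le_succ _)
  obtain ⟨N, L, R, hN, hrep, hLR, hcut⟩ := hG.exists_evenRep
  rw [Fintype.card_fin] at hN
  -- The region from 1 to 2 * N + 1 contains all intervals, and none meets its two ends.
  obtain ⟨inv₃, hbound⟩ := inv₂.rounds hsymm hQ
    (BoundedBy (n * n + 1) (Inter n A) L R 1 (2 * N + 1)) (.zero hrep.le)
    (fun t T T' himp h => h.succ hrep.le (fun x y hxy => by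
        rcases (hA x y).1 hxy with rfl | h
        · exact ⟨hrep.le x, hrep.le x⟩
        · exact ((hrep.adj x y).1 h).2) (fun z _ _ => exists_isCut hA hLR hcut z) himp)
  rw [hs₃] at inv₃ hbound
  have hempty : ∀ z, z = 1 ∨ z = 2 * N + 1 → IsCut (Inter n A) L R (n * n) z := fun z hz x =>
    iff_of_false (not_inter_sq n A x) (by have := hLR x; omega)
  obtain ⟨o1, o2⟩ := Stm.run_output (q := n * n) inv₃.consts (by
      rw [g₃.reg 2 (by decide), g₂.reg 2 (by decide), g₁.reg 2 (by decide)]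
      simp [input])
    ((g₃.reg 3 (by decide)).trans ((g₂.reg 3 (by decide)).trans h3)) (Nat.lt_succ_self _)
  have hfree : ∀ x, Free (Inter n A) (n * n) (n * n) x := fun x =>
    ⟨not_inter_sq n A x, not_inter_sq n A x⟩
  have hgood := inv₃.good (n * n) (Nat.lt_succ_self _) (n * n) (Nat.lt_succ_self _)
  obtain ⟨t, ht, ht'⟩ := Stm.sizes.exec_compile (B := [0]) (by decide) n (input G ψ)
    (by simp [hin])
  obtain ⟨t', hx, hx'⟩ := Stm.main.exec_compile (B := [0, 4]) (by decide) (n * n + 1) s₁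
    (by simp [h0, h4, hQ])
  rw [hs₁] at ht
  refine ⟨_, _, .seq ht hx, ?_, (Stm.output.run s₃).reg 2,
    fun x => ⟨s₃.table n (n * n + 1) 7 (n * n) (n * n) x,
      (hgood.lt x x.2 (hfree x)).trans_le (o1 x x.2).2⟩, o2 _ fun x hx => ?_, ?_, ?_, fun x => ?_⟩
  · simp only [Polynomial.eval_add, Polynomial.eval_comp, Polynomial.eval_mul, Polynomial.eval_X,
      Polynomial.eval_one]
    omega
  -- The n² + 1 rounds reach a region of length 2 * N because 2 * N ≤ 2 * n ≤ n² + 1.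
  · refine hbound 1 (2 * N + 1) (k ^ 2) le_rfl le_rfl (by nlinarith) _ (Nat.lt_succ_self _) _
      (Nat.lt_succ_self _) (hempty 1 (.inl rfl)) (hempty _ (.inr rfl)) (hrep.cutTree hψ _ _)
      ⟨x, hx⟩ ?_ ?_
    · have := hLR ⟨x, hx⟩; omega
    · have := hLR ⟨x, hx⟩; omega
  · exact isCenteredColoring_of_goodCol (fun x y h => (hA x y).2 (.inr h)) hfree hgood _
      fun x => rfl
  · simp only [Stm.main, Stm.run, hs₂, hs₃]
  · simp only [Stm.main, Stm.run, hs₂, hs₃]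
    exact (o1 x x.2).1
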